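/- Let $n\ge 2$ and let $\theta=(\theta_{jk})$ be a real antisymmetric $n\times n$ matrix with columns $\theta_1,\dots,\theta_n$. Let $A_\theta$ be the $C^*$-algebra of operators on $L^2(\mathbb T^n)$, $\mathbb T^n=\mathbb R^n/2\pi\mathbb Z^n$, generated by the unitaries $(U_j\xi)(x)=e^{ix_j}\xi(x+\pi\theta_j)$, $j=1,\dots,n$; let $\tau(a)=(2\pi)^{-n}\int_{\mathbb T^n}(a1)(x)\,dx$ be its standard tracial state, and let $\mathscr H_\theta$ be the Hilbert space of the GNS representation of $\tau$, on which $A_\theta$ acts by left multiplication. Let $\alpha$ be the action of $\mathbb R^n$ on $A_\theta$ induced by translations of $\mathbb T^n$ (so $\alpha_s(U_j)=e^{is_j}U_j$), let $\mathscr A_\theta$ be the algebra of all $u\in A_\theta$ such that $s\mapsto\alpha_s(u)$ is $C^\infty$, and let $\delta_j(u)=\frac1i\partial_{s_j}\alpha_s(u)|_{s=0}$ for $u\in\mathscr A_\theta$. Let $\Delta=\delta_1^2+\dots+\delta_n^2$ be the flat Laplacian on $\mathscr A_\theta\subset\mathscr H_\theta$, and let $\Delta^{-n/2}=\sum_{\mu>0}\mu^{-n/2}\,\Pi_\mu$,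 where $\Pi_\mu$ is the orthogonal projection of $\mathscr H_\theta$ onto the eigenspace of $\Delta$ for the eigenvalue $\mu$ (so $\Delta^{-n/2}$ vanishes on $\ker\Delta=\mathbb C\cdot 1$). For a Hilbert space $\mathscr H$ let $\mathscr L^{1,\infty}$ be the ideal of compact operators $T$ on $\mathscr H$ whose singular values satisfy $\mu_k(T)=\mathrm O(k^{-1})$. A normalized positive trace on $\mathscr L^{1,\infty}$ is a linear form $\varphi:\mathscr L^{1,\infty}\to\mathbb C$ that vanishes on all commutators $[A,T]$ with $A$ bounded and $T\in\mathscr L^{1,\infty}$, is non-negative on positive operators, and satisfies $\varphi(T_0)=1$, where $T_0$ is any operator that is diagonal in an orthonormal basis with eigenvalues $1,\frac12,\frac13,\dots$. An operator $T\in\mathscr L^{1,\infty}$ is strongly measurable if there is $L\in\mathbb C$ such that $\varphi(T)=L$ for every normalized positive trace $\varphi$ on $\mathscr L^{1,\infty}$; this value is its noncommutative integral ${\int\!\!\!\!\!-}\,T:=L$. Then, for every $a\in A_\theta$, the operator $a\Delta^{-n/2}$ on $\mathscr H_\theta$ is in $\mathscr L^{1,\infty}$ and strongly measurable, and $${\int\!\!\!\!\!\!-}\;a\Delta^{-n/2}=\hat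 c_n\,\tau(a),\qquad \hat c_n:=\frac1n\,|\mathbb S^{n-1}|,$$ where $|\mathbb S^{n-1}|$ is the surface area of the unit sphere of $\mathbb R^n$. -/

import Mathlib

open scoped ComplexOrder InnerProductSpace ENNReal ContDiff
open MeasureTheory

noncomputable section

namespace WeakTrace

variable {H : Type*} [NormedAddCommGroup H] [InnerProductSpace ℂ H]

/-- The norm of the restriction of `T` to the orthogonal complement of `E`. -/
def restrNorm (T : H →L[ℂ] H) (E : Submodule ℂ H) : ℝ := ‖T ∘L Eᗮ.subtypeL‖

/-- The `k`-th characteristic value (singular value)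
`μ_k(T) = inf {‖T|_{Eᗮ}‖ ; dim E ≤ k}`. As `‖T|_{Eᗮ}‖` decreases when `E` grows, on a space of
dimension at least `k` this is the infimum over the subspaces of dimension exactly `k`. -/
def mu (T : H →L[ℂ] H) (k : ℕ) : ℝ :=
  sInf {c : ℝ | ∃ E : Submodule ℂ H, FiniteDimensional ℂ E ∧ Module.finrank ℂ E ≤ k ∧
    c = restrNorm T E}

theorem restrNorm_nonneg (T : H →L[ℂ] H) (E : Submodule ℂ H) : 0 ≤ restrNorm T E := by
  exact norm_nonneg (T ∘L Eᗮ.subtypeL)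

theorem norm_apply_le_restrNorm (T : H →L[ℂ] H) (E : Submodule ℂ H) {x : H} (hx : x ∈ Eᗮ) :
    ‖T x‖ ≤ restrNorm T E * ‖x‖ :=
  (T ∘L Eᗮ.subtypeL).le_opNorm ⟨x, hx⟩

theorem restrNorm_le (T : H →L[ℂ] H) (E : Submodule ℂ H) {c : ℝ} (hc : 0 ≤ c)
    (h : ∀ x ∈ Eᗮ, ‖T x‖ ≤ c * ‖x‖) : restrNorm T E ≤ c :=
  ContinuousLinearMap.opNorm_le_bound _ hc fun x => h x x.2

theorem mu_le (T : H →L[ℂ] H) (E : Submodule ℂ H) [FiniteDimensional ℂ E] {k : ℕ}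
    (h : Module.finrank ℂ E ≤ k) : mu T k ≤ restrNorm T E :=
  csInf_le ⟨0, by rintro _ ⟨E, -, -, rfl⟩; exact restrNorm_nonneg T E⟩ ⟨E, inferInstance, h, rfl⟩

theorem mu_nonneg (T : H →L[ℂ] H) (k : ℕ) : 0 ≤ mu T k :=
  Real.sInf_nonneg (by rintro _ ⟨E, -, -, rfl⟩; exact restrNorm_nonneg T E)

theorem exists_restrNorm_lt (T : H →L[ℂ] H) (k : ℕ) {ε : ℝ} (hε : 0 < ε) :
    ∃ E : Submodule ℂ H, FiniteDimensional ℂ E ∧ Module.finrank ℂ E ≤ k ∧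
      restrNorm T E < mu T k + ε := by
  obtain ⟨_, ⟨E, h1, h2, rfl⟩, h⟩ := exists_lt_of_csInf_lt
    (s := {c : ℝ | ∃ E : Submodule ℂ H, FiniteDimensional ℂ E ∧ Module.finrank ℂ E ≤ k ∧
      c = restrNorm T E})
    ⟨_, ⊥, inferInstance, by simp, rfl⟩ (lt_add_of_pos_right (mu T k) hε)
  exact ⟨E, h1, h2, h⟩

theorem mu_add_le (S T : H →L[ℂ] H) (k l : ℕ) : mu (S + T) (k + l) ≤ mu S k + mu T l := by
  refine le_of_forall_pos_le_add fun ε hε => ?_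
  obtain ⟨E, _, hE, hE'⟩ := exists_restrNorm_lt S k (half_pos hε)
  obtain ⟨F, _, hF, hF'⟩ := exists_restrNorm_lt T l (half_pos hε)
  have h1 : Module.finrank ℂ ↥(E ⊔ F) ≤ k + l :=
    (Submodule.finrank_add_le_finrank_add_finrank E F).trans (add_le_add hE hF)
  have h2 : restrNorm (S + T) (E ⊔ F) ≤ restrNorm S E + restrNorm T F := by
    refine restrNorm_le _ _ (add_nonneg (restrNorm_nonneg _ _) (restrNorm_nonneg _ _)) ?_
    intro x hx
    rw [add_mul]
    exact (norm_add_le _ _).trans (add_le_add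
      (norm_apply_le_restrNorm S E (Submodule.orthogonal_le le_sup_left hx))
      (norm_apply_le_restrNorm T F (Submodule.orthogonal_le le_sup_right hx)))
  linarith [mu_le (S + T) (E ⊔ F) h1]

theorem mu_antitone (T : H →L[ℂ] H) {k l : ℕ} (h : k ≤ l) : mu T l ≤ mu T k := by
  refine le_of_forall_pos_le_add fun ε hε => ?_
  obtain ⟨E, _, hE, hE'⟩ := exists_restrNorm_lt T k hε
  exact (mu_le T E (hE.trans h)).trans hE'.le

theorem mu_comp_left_le (A T : H →L[ℂ] H) (k : ℕ) : mu (A ∘L T) k ≤ ‖A‖ * mu T k := by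
  refine le_of_forall_pos_le_add fun ε hε => ?_
  obtain ⟨E, _, hE, hE'⟩ := exists_restrNorm_lt T k
    (show 0 < ε / (‖A‖ + 1) by positivity)
  have h2 : restrNorm (A ∘L T) E ≤ ‖A‖ * restrNorm T E := by
    refine restrNorm_le _ _ (mul_nonneg (norm_nonneg _) (restrNorm_nonneg _ _)) fun x hx => ?_
    rw [mul_assoc]
    exact (A.le_opNorm _).trans
      (mul_le_mul_of_nonneg_left (norm_apply_le_restrNorm T E hx) (norm_nonneg _))
  have h3 : ‖A‖ * (ε / (‖A‖ + 1)) ≤ ε := by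
    rw [mul_div_assoc', div_le_iff₀ (by positivity)]
    nlinarith [norm_nonneg A]
  nlinarith [mu_le (A ∘L T) E hE, norm_nonneg A,
    mul_le_mul_of_nonneg_left hE'.le (norm_nonneg A)]

theorem mu_comp_right_le [CompleteSpace H] (T A : H →L[ℂ] H) (k : ℕ) :
    mu (T ∘L A) k ≤ mu T k * ‖A‖ := by
  refine le_of_forall_pos_le_add fun ε hε => ?_
  obtain ⟨E, _, hE, hE'⟩ := exists_restrNorm_lt T k
    (show 0 < ε / (‖A‖ + 1) by positivity)
  let F : Submodule ℂ H := E.map (ContinuousLinearMap.adjoint A).toLinearMap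
  have hF : Module.finrank ℂ F ≤ k := (Submodule.finrank_map_le _ _).trans hE
  have h2 : restrNorm (T ∘L A) F ≤ restrNorm T E * ‖A‖ := by
    refine restrNorm_le _ _ (mul_nonneg (restrNorm_nonneg _ _) (norm_nonneg _)) fun x hx => ?_
    have hAx : A x ∈ Eᗮ := by
      rw [Submodule.mem_orthogonal] at hx ⊢
      intro u hu
      rw [← ContinuousLinearMap.adjoint_inner_left]
      exact hx _ (Submodule.mem_map_of_mem hu)
    rw [mul_assoc]
    exact (norm_apply_le_restrNorm T E hAx).trans
      (mul_le_mul_of_nonneg_left (A.le_opNorm _) (restrNorm_nonneg _ _))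
  have h3 : (ε / (‖A‖ + 1)) * ‖A‖ ≤ ε := by
    rw [div_mul_eq_mul_div, div_le_iff₀ (by positivity)]
    nlinarith [norm_nonneg A]
  nlinarith [mu_le (T ∘L A) F hF, norm_nonneg A,
    mul_le_mul_of_nonneg_right hE'.le (norm_nonneg A)]

variable [CompleteSpace H]

/-- The weak trace class `ℒ^{1,∞}`: the compact operators `T` with `μ_k(T) = O(1/k)`. -/
def weakTraceClass (H : Type*) [NormedAddCommGroup H] [InnerProductSpace ℂ H] [CompleteSpace H] :
    Submodule ℂ (H →L[ℂ] H) where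
  carrier := {T | IsCompactOperator T ∧ ∃ C : ℝ, ∀ k : ℕ, mu T k ≤ C / (k + 1)}
  zero_mem' := by
    refine ⟨isCompactOperator_zero, 0, fun k => ?_⟩
    refine (mu_le 0 ⊥ (by simp)).trans (restrNorm_le _ _ (by simp) fun x _ => ?_)
    simp
  add_mem' := by
    rintro S T ⟨hS, C, hC⟩ ⟨hT, D, hD⟩
    refine ⟨hS.add hT, 2 * (C + D), fun k => ?_⟩
    have hCD : 0 ≤ C + D := by
      have h1 := (mu_nonneg S 0).trans (hC 0)
      have h2 := (mu_nonneg T 0).trans (hD 0)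
      simp at h1 h2
      linarith
    have h1 : mu (S + T) k ≤ mu S (k / 2) + mu T (k / 2) :=
      (mu_antitone _ (by omega)).trans (mu_add_le S T (k / 2) (k / 2))
    have h2 : ((k : ℝ) + 1) ≤ 2 * (((k / 2 : ℕ) : ℝ) + 1) := by
      have : k + 1 ≤ 2 * (k / 2 + 1) := by omega
      exact_mod_cast this
    calc mu (S + T) k ≤ (C + D) / (((k / 2 : ℕ) : ℝ) + 1) := by
          rw [add_div]; exact h1.trans (add_le_add (hC _) (hD _))
      _ ≤ 2 * (C + D) / (k + 1) := by
          rw [div_le_div_iff₀ (by positivity) (by positivity)]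
          nlinarith
  smul_mem' := by
    rintro c T ⟨hT, C, hC⟩
    refine ⟨hT.smul c, ‖c • ContinuousLinearMap.id ℂ H‖ * C, fun k => ?_⟩
    have h : c • T = (c • ContinuousLinearMap.id ℂ H) ∘L T := by ext; simp
    rw [h, mul_div_assoc]
    exact (mu_comp_left_le _ _ _).trans (mul_le_mul_of_nonneg_left (hC k) (norm_nonneg _))

theorem comp_left_mem (A : H →L[ℂ] H) {T : H →L[ℂ] H} (hT : T ∈ weakTraceClass H) :
    A ∘L T ∈ weakTraceClass H := by
  obtain ⟨hT, C, hC⟩ := hT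
  refine ⟨hT.clm_comp A, ‖A‖ * C, fun k => ?_⟩
  rw [mul_div_assoc]
  exact (mu_comp_left_le _ _ _).trans (mul_le_mul_of_nonneg_left (hC k) (norm_nonneg _))

theorem comp_right_mem (A : H →L[ℂ] H) {T : H →L[ℂ] H} (hT : T ∈ weakTraceClass H) :
    T ∘L A ∈ weakTraceClass H := by
  obtain ⟨hT, C, hC⟩ := hT
  refine ⟨hT.comp_clm A, C * ‖A‖, fun k => ?_⟩
  rw [mul_div_right_comm]
  exact (mu_comp_right_le _ _ _).trans (mul_le_mul_of_nonneg_right (hC k) (norm_nonneg _))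

/-- The commutator `[A, T]` of a bounded operator and a weak trace class operator. -/
def commutator (A : H →L[ℂ] H) (T : weakTraceClass H) : weakTraceClass H :=
  ⟨A ∘L (T : H →L[ℂ] H) - (T : H →L[ℂ] H) ∘L A,
    Submodule.sub_mem _ (comp_left_mem A T.2) (comp_right_mem A T.2)⟩

/-- `T` is diagonal in some orthonormal basis `(ξ_k)_{k ≥ 0}` with `T ξ_k = (k+1)⁻¹ ξ_k`. -/
def IsHarmonic (T : H →L[ℂ] H) : Prop :=
  ∃ ξ : HilbertBasis ℕ ℂ H, ∀ k : ℕ, T (ξ k) = ((k : ℂ) + 1)⁻¹ • ξ k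

/-- Normalized positive traces on `ℒ^{1,∞}`: linear forms that vanish on all commutators
`[A, T]`, are non-negative on positive operators, and take the value `1` on an operator with
eigenvalue sequence `1, 1/2, 1/3, …`; all such operators are unitarily equivalent, and so the
choice does not matter. -/
structure IsNormalizedPositiveTrace (φ : weakTraceClass H →ₗ[ℂ] ℂ) : Prop where
  map_commutator : ∀ (A : H →L[ℂ] H) (T : weakTraceClass H), φ (commutator A T) = 0
  nonneg : ∀ T : weakTraceClass H, (T : H →L[ℂ] H).IsPositive → 0 ≤ φ T
  normalized : ∃ T₀ : weakTraceClass H, IsHarmonic (T₀ : H →L[ℂ] H) ∧ φ T₀ = 1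

/-- `T` belongs to `ℒ^{1,∞}` and every normalized positive trace on `ℒ^{1,∞}` takes the value `L`
at `T`, i.e. `T` is strongly measurable with noncommutative integral `⨍ T = L`. -/
def HasNCIntegral (T : H →L[ℂ] H) (L : ℂ) : Prop :=
  ∃ hT : T ∈ weakTraceClass H, ∀ φ : weakTraceClass H →ₗ[ℂ] ℂ,
    IsNormalizedPositiveTrace φ → φ ⟨T, hT⟩ = L

/-- Strongly measurable operators. -/
def IsStronglyMeasurable (T : H →L[ℂ] H) : Prop := ∃ L : ℂ, HasNCIntegral T L

end WeakTrace

namespace NCTorus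

variable {n : ℕ}

/-- The normalized Haar measure on `𝕋ⁿ = (ℝ/ℤ)ⁿ`; in the coordinates `x = 2πt ∈ (ℝ/2πℤ)ⁿ` it is
`(2π)⁻ⁿ dx`. -/
abbrev haar (n : ℕ) : Measure (UnitAddTorus (Fin n)) :=
  Measure.pi fun _ => AddCircle.haarAddCircle

/-- The Hilbert space `L²(𝕋ⁿ)`. -/
abbrev L2 (n : ℕ) : Type := Lp ℂ 2 (haar n)

/-- The algebra of bounded operators on `L²(𝕋ⁿ)`. -/
abbrev Op (n : ℕ) : Type := L2 n →L[ℂ] L2 n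

/-- The translation operator `(V_t ξ)(x) = ξ(x + t)`. -/
def shift (t : UnitAddTorus (Fin n)) : Op n :=
  (Lp.compMeasurePreservingₗᵢ ℂ (fun x => x + t)
    (measurePreserving_add_right (haar n) t)).toContinuousLinearMap

/-- Multiplication by a continuous function on `L²(𝕋ⁿ)`. -/
def mulOp (f : C(UnitAddTorus (Fin n), ℂ)) : Op n :=
  (ContinuousLinearMap.mul ℂ ℂ).holderL (haar n) ∞ 2 2 (f.toLp ∞ (haar n) ℂ)

theorem coeFn_shift (t : UnitAddTorus (Fin n)) (ξ : L2 n) :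
    shift t ξ =ᵐ[haar n] fun x => ξ (x + t) :=
  Lp.coeFn_compMeasurePreserving ξ (measurePreserving_add_right (haar n) t)

theorem coeFn_mulOp (f : C(UnitAddTorus (Fin n), ℂ)) (ξ : L2 n) :
    mulOp f ξ =ᵐ[haar n] fun x => f x * ξ x := by
  filter_upwards [ContinuousLinearMap.coeFn_holder (r := 2) (ContinuousLinearMap.mul ℂ ℂ)
    (f.toLp ∞ (haar n) ℂ) ξ, ContinuousMap.coeFn_toLp (p := ∞) (𝕜 := ℂ) (haar n) f] with x h1 h2
  rw [← h2]
  exact h1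

/-- The unitary operator `(U_j ξ)(x) = e^{i x_j} ξ(x + π θ_j)`, with `θ_j` the `j`-th column of `θ`;
in the coordinate `t = x / 2π` this is `e^{2π i t_j} ξ(t + θ_j / 2)`. -/
def U (θ : Matrix (Fin n) (Fin n) ℝ) (j : Fin n) : Op n :=
  mulOp (UnitAddTorus.mFourier (Pi.single j 1)) ∘L
    shift (fun l => ((θ l j / 2 : ℝ) : UnitAddCircle))

/-- The C*-algebra generated by `U_1, …, U_n`, as a *-subalgebra of the bounded operators on
`L²(𝕋ⁿ)`. -/
def algebraOf (θ : Matrix (Fin n) (Fin n) ℝ) : StarSubalgebra ℂ (Op n) :=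
  (StarAlgebra.adjoin ℂ (Set.range (U θ))).topologicalClosure

theorem shift_add (s t : UnitAddTorus (Fin n)) : shift (s + t) = shift s ∘L shift t := by
  ext1 ξ
  apply Lp.ext
  have h := (measurePreserving_add_right (haar n) s).quasiMeasurePreserving.ae (coeFn_shift t ξ)
  filter_upwards [coeFn_shift (s + t) ξ, coeFn_shift s (shift t ξ), h] with x h1 h2 h3
  rw [h1, ContinuousLinearMap.comp_apply, h2, h3, add_assoc]

theorem shift_zero : shift (0 : UnitAddTorus (Fin n)) = 1 := by
  ext1 ξ
  apply Lp.ext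
  filter_upwards [coeFn_shift 0 ξ] with x h1
  rw [h1, add_zero]
  rfl

theorem star_shift (t : UnitAddTorus (Fin n)) : star (shift t) = shift (-t) := by
  have h1 : star (shift t) * shift t = 1 := by
    rw [ContinuousLinearMap.star_eq_adjoint]
    exact (ContinuousLinearMap.norm_map_iff_adjoint_comp_self _).1 fun ξ =>
      (Lp.compMeasurePreservingₗᵢ ℂ (fun x => x + t)
        (measurePreserving_add_right (haar n) t)).norm_map ξ
  have h2 : shift t * shift (-t) = 1 := by
    rw [← shift_zero, ← add_neg_cancel t, shift_add]; rfl
  exact left_inv_eq_right_inv h1 h2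

/-- The translation operator as a unitary. -/
def shiftU (t : UnitAddTorus (Fin n)) : unitary (Op n) :=
  ⟨shift t, by
    rw [Unitary.mem_iff, star_shift]
    constructor
    · change shift (-t) ∘L shift t = 1
      rw [← shift_add, neg_add_cancel, shift_zero]
    · change shift t ∘L shift (-t) = 1
      rw [← shift_add, add_neg_cancel, shift_zero]⟩

/-- The point of `𝕋ⁿ = (ℝ/ℤ)ⁿ` that corresponds to `s ∈ ℝⁿ` modulo `2πℤⁿ`. -/
def angle (s : Fin n → ℝ) : UnitAddTorus (Fin n) := fun j => ((s j / (2 * Real.pi) : ℝ) : UnitAddCircle)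

theorem angle_add (s t : Fin n → ℝ) : angle (s + t) = angle s + angle t := by
  funext j
  simp [angle, add_div]

theorem angle_zero : angle (0 : Fin n → ℝ) = 0 := by
  funext j
  simp [angle]

/-- The action of `ℝⁿ` on operators that is induced by the translations: `T ↦ V_s T V_s⁻¹`. -/
def conj (s : Fin n → ℝ) : Op n ≃⋆ₐ[ℂ] Op n := Unitary.conjStarAlgAut ℂ (Op n) (shiftU (angle s))

theorem conj_apply (s : Fin n → ℝ) (T : Op n) :
    conj s T = shift (angle s) * T * shift (-angle s) := by
  rw [conj, Unitary.conjStarAlgAut_apply]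
  change shift (angle s) * T * star (shift (angle s)) = _
  rw [star_shift]

theorem continuous_conj (s : Fin n → ℝ) : Continuous (conj (n := n) s) := by
  have : (conj (n := n) s : Op n → Op n) = fun T => shift (angle s) * T * shift (-angle s) :=
    funext (conj_apply s)
  rw [this]
  fun_prop

theorem conj_conj (s t : Fin n → ℝ) (T : Op n) : conj s (conj t T) = conj (s + t) T := by
  have h : shift (angle (s + t)) = shift (angle s) * shift (angle t) := by
    rw [angle_add, shift_add]; rfl
  have h' : shift (-angle (s + t)) = shift (-angle t) * shift (-angle s) := by
    rw [angle_add, neg_add_rev, shift_add]; rfl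
  simp only [conj_apply, h, h', mul_assoc]

theorem conj_U (s : Fin n → ℝ) (θ : Matrix (Fin n) (Fin n) ℝ) (j : Fin n) :
    conj s (U θ j) = Complex.exp (Complex.I * s j) • U θ j := by
  have h1 : shift (angle s) ∘L mulOp (UnitAddTorus.mFourier (Pi.single j 1)) =
      (Complex.exp (Complex.I * s j)) •
        (mulOp (UnitAddTorus.mFourier (Pi.single j 1)) ∘L shift (angle s)) := by
    ext1 ξ
    apply Lp.ext
    have h := (measurePreserving_add_right (haar n) (angle s)).quasiMeasurePreserving.ae
      (coeFn_mulOp (UnitAddTorus.mFourier (Pi.single j 1)) ξ)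
    have h' := coeFn_mulOp (UnitAddTorus.mFourier (Pi.single j 1)) (shift (angle s) ξ)
    have h'' := Lp.coeFn_smul (Complex.exp (Complex.I * s j))
      (mulOp (UnitAddTorus.mFourier (Pi.single j 1)) (shift (angle s) ξ))
    filter_upwards [coeFn_shift (angle s) (mulOp (UnitAddTorus.mFourier (Pi.single j 1)) ξ), h, h',
      h'', coeFn_shift (angle s) ξ] with x e1 e2 e3 e4 e5
    simp only [ContinuousLinearMap.comp_apply, _root_.smul_apply]
    rw [e1, e2, e4, Pi.smul_apply, e3, e5]
    have key : UnitAddTorus.mFourier (Pi.single j 1) (x + angle s) =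
        Complex.exp (Complex.I * s j) * UnitAddTorus.mFourier (Pi.single j 1) x := by
      rw [UnitAddTorus.mFourier_single, UnitAddTorus.mFourier_single]
      simp only [Pi.add_apply, angle]
      rw [fourier_one, fourier_one, AddCircle.toCircle_add, Circle.coe_mul, mul_comm]
      congr 1
      rw [AddCircle.toCircle_apply_mk, Circle.coe_exp]
      congr 1
      push_cast
      field_simp
    rw [key, smul_eq_mul, mul_assoc]
  rw [conj_apply]
  have h2 : shift (angle s) * U θ j * shift (-angle s) =
      (shift (angle s) ∘L mulOp (UnitAddTorus.mFourier (Pi.single j 1))) ∘L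
        (shift (fun l => ((θ l j / 2 : ℝ) : UnitAddCircle)) ∘L shift (-angle s)) := rfl
  rw [h2, h1, ContinuousLinearMap.smul_comp]
  congr 1
  rw [ContinuousLinearMap.comp_assoc, ← shift_add, ← shift_add, U]
  congr 2
  abel

theorem conj_mem (s : Fin n → ℝ) (θ : Matrix (Fin n) (Fin n) ℝ) {T : Op n}
    (hT : T ∈ algebraOf θ) : conj s T ∈ algebraOf θ := by
  let A : StarSubalgebra ℂ (Op n) := (algebraOf θ).comap (conj s).toStarAlgHom
  have hA : IsClosed (A : Set (Op n)) :=
    (StarSubalgebra.isClosed_topologicalClosure _).preimage (continuous_conj s)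
  have h : algebraOf θ ≤ A := by
    refine StarSubalgebra.topologicalClosure_minimal (StarAlgebra.adjoin_le ?_) hA
    rintro _ ⟨j, rfl⟩
    change conj s (U θ j) ∈ algebraOf θ
    rw [conj_U]
    exact SMulMemClass.smul_mem _ (StarSubalgebra.le_topologicalClosure _
      (StarAlgebra.subset_adjoin ℂ _ ⟨j, rfl⟩))
  exact h hT

end NCTorus

/-- The noncommutative torus `A_θ = C(𝕋ⁿ_θ)`: the C*-algebra generated by the unitaries `U_j`. -/
def NCTorus {n : ℕ} (θ : Matrix (Fin n) (Fin n) ℝ) : Type := NCTorus.algebraOf θ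

namespace NCTorus

variable {n : ℕ} (θ : Matrix (Fin n) (Fin n) ℝ)

instance : IsClosed (algebraOf θ : Set (Op n)) := StarSubalgebra.isClosed_topologicalClosure _

instance : CStarAlgebra (NCTorus θ) := inferInstanceAs (CStarAlgebra (algebraOf θ))

/-- The order of the C*-algebra `A_θ`: `a ≤ b` when `b - a` is selfadjoint with non-negative
spectrum. -/
instance : PartialOrder (NCTorus θ) := CStarAlgebra.spectralOrder _

instance : StarOrderedRing (NCTorus θ) := CStarAlgebra.spectralOrderedRing _

/-- The inclusion of `A_θ` in the bounded operators on `L²(𝕋ⁿ)`. -/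
def toOp : NCTorus θ →⋆ₐ[ℂ] Op n := (algebraOf θ).subtype

/-- The constant function `1` in `L²(𝕋ⁿ)`. -/
def one2 (n : ℕ) : L2 n := ContinuousMap.toLp 2 (haar n) ℂ 1

/-- The tracial state `τ(a) = ⟨a 1, 1⟩` of `A_θ`. -/
def tau : NCTorus θ →ₚ[ℂ] ℂ :=
  .mk₀ { toFun := fun a => ⟪one2 n, toOp θ a (one2 n)⟫_ℂ
         map_add' := fun a b => by simp [inner_add_right]
         map_smul' := fun c a => by simp [inner_smul_right] } fun a ha => by
    obtain ⟨b, rfl⟩ := CStarAlgebra.nonneg_iff_eq_star_mul_self.1 ha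
    have : ⟪one2 n, toOp θ (star b * b) (one2 n)⟫_ℂ =
        ⟪toOp θ b (one2 n), toOp θ b (one2 n)⟫_ℂ := by
      rw [map_mul, map_star, mul_apply_eq_comp, ContinuousLinearMap.star_eq_adjoint,
        ContinuousLinearMap.adjoint_inner_right]
    change 0 ≤ ⟪one2 n, toOp θ (star b * b) (one2 n)⟫_ℂ
    rw [this, inner_self_eq_norm_sq_to_K]
    exact Complex.zero_le_real.2 (sq_nonneg _) |>.trans_eq (Complex.ofReal_pow _ _)

/-- The Hilbert space `ℋ_θ = L²(𝕋ⁿ_θ)` of the GNS representation of `τ`. -/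
abbrev Hilb : Type := (tau θ).GNS

/-- The canonical map `A_θ → ℋ_θ`. -/
def toHilb : NCTorus θ →ₗ[ℂ] Hilb θ :=
  (UniformSpace.Completion.toComplₗᵢ (𝕜 := ℂ) (E := (tau θ).PreGNS)).toLinearMap ∘ₗ
    (tau θ).toPreGNS.toLinearMap

/-- The GNS representation of `A_θ` in `ℋ_θ`, by left multiplication. -/
def leftMul : NCTorus θ →⋆ₐ[ℂ] (Hilb θ →L[ℂ] Hilb θ) := (tau θ).gnsStarAlgHom

/-- The action `α` of `ℝⁿ` on `A_θ` that is induced by the translations of `𝕋ⁿ`. -/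
def alpha (s : Fin n → ℝ) : NCTorus θ →L[ℂ] NCTorus θ where
  toFun a := (⟨conj s (toOp θ a), conj_mem s θ a.2⟩ : algebraOf θ)
  map_add' a b := Subtype.ext ((congrArg (conj s) (map_add (toOp θ) a b)).trans (map_add (conj s) _ _))
  map_smul' c a := Subtype.ext ((congrArg (conj s) (map_smul (toOp θ) c a)).trans (map_smul (conj s) _ _))
  cont := ((continuous_conj s).comp continuous_subtype_val).subtype_mk _

theorem toOp_alpha (s : Fin n → ℝ) (a : NCTorus θ) : toOp θ (alpha θ s a) = conj s (toOp θ a) := rfl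

theorem alpha_alpha (s t : Fin n → ℝ) (a : NCTorus θ) :
    alpha θ s (alpha θ t a) = alpha θ (s + t) a :=
  Subtype.ext (conj_conj s t (toOp θ a))

/-- The smooth noncommutative torus `C^∞(𝕋ⁿ_θ)`: the elements `u` of `A_θ` for which
`s ↦ α_s(u)` is a `C^∞` map from `ℝⁿ` to `A_θ`. -/
def smooth : Submodule ℂ (NCTorus θ) where
  carrier := {u | ContDiff ℝ ∞ fun s : Fin n → ℝ => alpha θ s u}
  zero_mem' := by simpa using contDiff_const
  add_mem' {u v} hu hv := by
    rw [Set.mem_ofPred_eq] at hu hv ⊢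
    simpa using hu.add hv
  smul_mem' c u hu := by
    rw [Set.mem_ofPred_eq] at hu ⊢
    simpa using hu.const_smul c

theorem contDiff_alpha {u : NCTorus θ} (hu : u ∈ smooth θ) :
    ContDiff ℝ ∞ fun s : Fin n → ℝ => alpha θ s u := hu

theorem differentiable_alpha {u : NCTorus θ} (hu : u ∈ smooth θ) :
    Differentiable ℝ fun s : Fin n → ℝ => alpha θ s u :=
  (contDiff_alpha θ hu).differentiable (by simp)

/-- The partial derivative of `s ↦ α_s(u)` in the direction of the `j`-th coordinate. -/
def partialAlpha (j : Fin n) (u : NCTorus θ) (s : Fin n → ℝ) : NCTorus θ :=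
  fderiv ℝ (fun s : Fin n → ℝ => alpha θ s u) s (Pi.single j 1)

theorem alpha_partialAlpha (j : Fin n) {u : NCTorus θ} (hu : u ∈ smooth θ) (s : Fin n → ℝ) :
    alpha θ s (partialAlpha θ j u 0) = partialAlpha θ j u s := by
  have hd : Differentiable ℝ fun s : Fin n → ℝ => alpha θ s u :=
    differentiable_alpha θ hu
  have h1 : HasFDerivAt (fun t : Fin n → ℝ => alpha θ s (alpha θ t u))
      (((alpha θ s).restrictScalars ℝ).comp (fderiv ℝ (fun s : Fin n → ℝ => alpha θ s u) 0)) 0 :=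
    ((alpha θ s).restrictScalars ℝ).hasFDerivAt.comp 0 (hd 0).hasFDerivAt
  have h2 : HasFDerivAt (fun t : Fin n → ℝ => alpha θ (s + t) u)
      (fderiv ℝ (fun s : Fin n → ℝ => alpha θ s u) s) 0 := by
    have := (hd (s + 0)).hasFDerivAt.comp (0 : Fin n → ℝ) ((hasFDerivAt_id 0).const_add s)
    simpa [Function.comp_def] using this
  simp only [alpha_alpha] at h1
  have := congrArg (fun L : (Fin n → ℝ) →L[ℝ] NCTorus θ => L (Pi.single j 1)) (h1.unique h2)
  simpa [partialAlpha] using this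

theorem partialAlpha_mem (j : Fin n) {u : NCTorus θ} (hu : u ∈ smooth θ) :
    partialAlpha θ j u 0 ∈ smooth θ := by
  change ContDiff ℝ ∞ fun s : Fin n → ℝ => alpha θ s (partialAlpha θ j u 0)
  simp only [alpha_partialAlpha θ j hu]
  exact ((contDiff_alpha θ hu).fderiv_right (m := ∞) (by simp)).clm_apply contDiff_const

/-- The derivation `δ_j(u) = (1/i) ∂_{s_j} α_s(u) |_{s = 0}` of the smooth noncommutative torus. -/
def delta (j : Fin n) : Module.End ℂ (smooth θ) where
  toFun u := ⟨(1 / Complex.I) • partialAlpha θ j u 0,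
    (smooth θ).smul_mem _ (partialAlpha_mem θ j u.2)⟩
  map_add' u v := by
    have hu : Differentiable ℝ fun s : Fin n → ℝ => alpha θ s u :=
      differentiable_alpha θ u.2
    have hv : Differentiable ℝ fun s : Fin n → ℝ => alpha θ s v :=
      differentiable_alpha θ v.2
    ext1
    simp [partialAlpha, fderiv_fun_add (hu 0) (hv 0)]
  map_smul' c u := by
    have hu : Differentiable ℝ fun s : Fin n → ℝ => alpha θ s u :=
      differentiable_alpha θ u.2
    ext1
    simp [partialAlpha, fderiv_fun_const_smul (hu 0), smul_comm c]

/-- The flat Laplacian `Δ = δ_1² + ⋯ + δ_n²` on the smooth noncommutative torus. -/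
def laplacian : Module.End ℂ (smooth θ) := ∑ j, delta θ j * delta θ j

/-- Let `D` be an operator in the Hilbert space `H`, with domain `V` (mapped to `H` by `ι`), that is
essentially selfadjoint with non-negative discrete spectrum. This is the power `D^{-s}`, `s > 0`,
in the sense of the functional calculus,
`D^{-s} = ∑_{μ > 0} μ^{-s} Π_μ`, with `Π_μ` the orthogonal projection onto the eigenspace of `D` for
the eigenvalue `μ`; by the usual convention `D^{-s}` vanishes on the kernel of `D`. The terms for
which `μ` is not an eigenvalue are zero, and the series converges in norm. -/
def negPower {V H : Type*} [AddCommGroup V] [Module ℂ V] [NormedAddCommGroup H]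
    [InnerProductSpace ℂ H] [CompleteSpace H] (D : Module.End ℂ V) (ι : V →ₗ[ℂ] H) (s : ℝ) :
    H →L[ℂ] H :=
  ∑' μ : {μ : ℝ // 0 < μ}, (((μ : ℝ) ^ (-s) : ℝ) : ℂ) •
    (((D.eigenspace ((μ : ℝ) : ℂ)).map ι).topologicalClosure).starProjection

/-- The operator `Δ^{-s}` on `ℋ_θ`, with `Δ` the flat Laplacian. -/
def laplacianNegPower (s : ℝ) : Hilb θ →L[ℂ] Hilb θ :=
  negPower (laplacian θ) (toHilb θ ∘ₗ (smooth θ).subtype) s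

end NCTorus

/-- The surface area `|𝕊^{n-1}|` of the unit sphere of `ℝⁿ`. -/
def sphereArea (n : ℕ) : ℝ := (volume : Measure (EuclideanSpace ℝ (Fin n))).toSphere.real Set.univ

end

/-
The Weyl unitaries are an orthonormal basis of `ℋ_θ` in which `Δ^{-n/2}` is diagonal, with
eigenvalues `|k|^{-n}`, `k ∈ ℤⁿ ∖ 0`. Counting lattice points in balls shows that the sorted
eigenvalues are asymptotic to `|𝕊^{n-1}| / (n m)`. A normalized positive trace `φ` is monotone and
vanishes on diagonal operators of finite rank, because the harmonic series diverges, so comparison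
with multiples of the harmonic operator gives `φ(Δ^{-n/2}) = |𝕊^{n-1}| / n`.

The functional `a ↦ φ(aΔ^{-n/2})` is positive, hence continuous, on `A_θ`. The translations of `𝕋ⁿ`
are implemented by unitaries of `ℋ_θ` that commute with `Δ`, so the functional vanishes on every
Weyl unitary of nonzero frequency, just as `τ` does. The span of the Weyl unitaries is dense, so the
functional is the multiple `φ(Δ^{-n/2}) τ` of `τ`.
-/

noncomputable section

open Filter Topology

section DiagonalOperators

variable {𝕜 ι κ H : Type*} [RCLike 𝕜] [NormedAddCommGroup H] [InnerProductSpace 𝕜 H]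
  (b : HilbertBasis ι 𝕜 H)

theorem clm_eq_of_eqOn_hilbertBasis {F : Type*} [TopologicalSpace F] [AddCommMonoid F] [Module 𝕜 F]
    [T2Space F] {S T : H →L[𝕜] F} (h : ∀ i, S (b i) = T (b i)) : S = T :=
  ContinuousLinearMap.ext_on (Submodule.dense_iff_topologicalClosure_eq_top.2 b.dense_span)
    (by rintro _ ⟨i, rfl⟩; exact h i)

theorem hasSum_norm_inner_sq (x : H) : HasSum (fun i => ‖⟪b i, x⟫_𝕜‖ ^ 2) (‖x‖ ^ 2) := by
  have h := (b.hasSum_inner_mul_inner x x).mapL RCLike.reCLM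
  simpa only [RCLike.reCLM_apply, inner_mul_symm_re_eq_norm, inner_self_eq_norm_sq, norm_mul,
    norm_inner_symm x, ← sq] using h

/-- The Hilbert basis `b` indexed through the bijection `e`. -/
def reindexHilbertBasis [CompleteSpace H] (e : κ ≃ ι) : HilbertBasis κ 𝕜 H :=
  HilbertBasis.mk (b.orthonormal.comp e e.injective)
    (by rw [e.surjective.range_comp]; exact b.dense_span.ge)

theorem reindexHilbertBasis_apply [CompleteSpace H] (e : κ ≃ ι) (k : κ) :
    reindexHilbertBasis b e k = b (e k) := by
  rw [reindexHilbertBasis, HilbertBasis.coe_mk, Function.comp_apply]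

/-- `T` is diagonal in the Hilbert basis `b`, with eigenvalue `d i` at the basis vector `b i`. -/
def IsDiagonal (d : ι → 𝕜) (T : H →L[𝕜] H) : Prop := ∀ i, T (b i) = d i • b i

theorem exists_isDiagonal {d : ι → 𝕜} {C : ℝ} (hd : ∀ i, ‖d i‖ ≤ C) :
    ∃ T : H →L[𝕜] H, IsDiagonal b d T := by
  classical
  have hd' : ∀ i, ‖d i • ContinuousLinearMap.id 𝕜 𝕜‖ ≤ max C 0 := fun i => by
    rw [norm_smul, ContinuousLinearMap.norm_id, mul_one]
    exact (hd i).trans (le_max_left C 0)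
  let M : lp (fun _ : ι => 𝕜) 2 →L[𝕜] lp (fun _ : ι => 𝕜) 2 :=
    lp.mapCLM 2 (fun i => d i • ContinuousLinearMap.id 𝕜 𝕜) (le_max_right C 0) hd'
  refine ⟨(b.repr.symm.toContinuousLinearEquiv : _ →L[𝕜] H) ∘L M ∘L
    (b.repr.toContinuousLinearEquiv : H →L[𝕜] _), fun i => b.repr.injective ?_⟩
  have hM : M (lp.single 2 i 1) = d i • lp.single 2 i 1 := by
    ext j
    rcases eq_or_ne j i with rfl | hj
    · simp [M]
    · simp [M, hj]
  simpa [b.repr_self] using hM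

variable {b}

namespace IsDiagonal

variable {S T : H →L[𝕜] H} {d e : ι → 𝕜}

protected theorem add (hS : IsDiagonal b d S) (hT : IsDiagonal b e T) :
    IsDiagonal b (fun i => d i + e i) (S + T) := fun i => by
  rw [_root_.add_apply, hS, hT, add_smul]

protected theorem sub (hS : IsDiagonal b d S) (hT : IsDiagonal b e T) :
    IsDiagonal b (fun i => d i - e i) (S - T) := fun i => by
  rw [_root_.sub_apply, hS, hT, sub_smul]

protected theorem smul (c : 𝕜) (hT : IsDiagonal b d T) :
    IsDiagonal b (fun i => c * d i) (c • T) := fun i => by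
  rw [_root_.smul_apply, hT, mul_smul]

protected theorem sum {α : Type*} {d : α → ι → 𝕜} {T : α → H →L[𝕜] H}
    (hT : ∀ a, IsDiagonal b (d a) (T a)) (s : Finset α) :
    IsDiagonal b (fun i => ∑ a ∈ s, d a i) (∑ a ∈ s, T a) := fun i => by
  rw [_root_.sum_apply, Finset.sum_smul]
  exact Finset.sum_congr rfl fun a _ => hT a i

theorem reindex [CompleteSpace H] (hT : IsDiagonal b d T) (σ : κ ≃ ι) :
    IsDiagonal (reindexHilbertBasis b σ) (fun k => d (σ k)) T := fun k => by
  rw [reindexHilbertBasis_apply, hT]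

theorem unique (hS : IsDiagonal b d S) (hT : IsDiagonal b d T) : S = T :=
  clm_eq_of_eqOn_hilbertBasis b fun i => (hS i).trans (hT i).symm

theorem inner_apply (hT : IsDiagonal b d T) (i : ι) (x : H) :
    ⟪b i, T x⟫_𝕜 = d i * ⟪b i, x⟫_𝕜 := by
  have h : innerSL 𝕜 (b i) ∘L T = d i • innerSL 𝕜 (b i) :=
    clm_eq_of_eqOn_hilbertBasis b fun j => by
      rcases eq_or_ne i j with rfl | hij
      · simp [hT i]
      · simp [hT j, b.orthonormal.2 hij]
  exact congrArg (fun L : H →L[𝕜] 𝕜 => L x) h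

theorem norm_apply_le (hT : IsDiagonal b d T) {C : ℝ} (hC : 0 ≤ C) {x : H}
    (h : ∀ i, ‖d i‖ ≤ C ∨ ⟪b i, x⟫_𝕜 = 0) : ‖T x‖ ≤ C * ‖x‖ := by
  refine le_of_sq_le_sq ?_ (by positivity)
  rw [mul_pow]
  refine hasSum_le (fun i => ?_) (hasSum_norm_inner_sq b (T x))
    ((hasSum_norm_inner_sq b x).mul_left _)
  rw [hT.inner_apply, norm_mul, mul_pow]
  rcases h i with h | h
  · gcongr
  · simp [h]

theorem norm_le (hT : IsDiagonal b d T) {C : ℝ} (hC : 0 ≤ C) (h : ∀ i, ‖d i‖ ≤ C) : ‖T‖ ≤ C :=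
  T.opNorm_le_bound hC fun _ => hT.norm_apply_le hC fun i => Or.inl (h i)

theorem inner_apply_left (hT : IsDiagonal b d T) (x : H) (i : ι) :
    ⟪T x, b i⟫_𝕜 = star (d i) * ⟪x, b i⟫_𝕜 := by
  rw [← inner_conj_symm, hT.inner_apply, map_mul, inner_conj_symm, RCLike.star_def]

theorem isPositive (hT : IsDiagonal b d T) (hd : ∀ i, 0 ≤ d i) : T.IsPositive := by
  refine T.isPositive_iff.2 ⟨fun x y => ?_, fun x => ?_⟩
  · refine (b.hasSum_inner_mul_inner (T x) y).unique
      ((b.hasSum_inner_mul_inner x (T y)).congr_fun fun i => ?_)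
    rw [hT.inner_apply_left, hT.inner_apply, (IsSelfAdjoint.of_nonneg (hd i)).star_eq]
    ring
  · refine (b.hasSum_inner_mul_inner (T x) x).nonneg fun i => ?_
    rw [hT.inner_apply_left, mul_assoc, ← inner_conj_symm x (b i), RCLike.conj_mul]
    exact mul_nonneg (star_nonneg_iff.2 (hd i)) (by positivity)

theorem tendsto {α : Type*} {l : Filter α} {D : α → ι → 𝕜} {F : α → H →L[𝕜] H}
    (hF : ∀ a, IsDiagonal b (D a) (F a)) (hT : IsDiagonal b d T) (h : TendstoUniformly D d l) :
    Tendsto F l (𝓝 T) := by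
  rw [Metric.tendsto_nhds]
  intro ε hε
  filter_upwards [Metric.tendstoUniformly_iff.1 h (ε / 2) (half_pos hε)] with a ha
  rw [dist_eq_norm]
  refine (((hF a).sub hT).norm_le (half_pos hε).le fun i => ?_).trans_lt (half_lt_self hε)
  rw [← dist_eq_norm, dist_comm]
  exact (ha i).le

end IsDiagonal

end DiagonalOperators

namespace WeakTrace

variable {H : Type*} [NormedAddCommGroup H] [InnerProductSpace ℂ H]

theorem norm_comp_starProjection_sub_le (T : H →L[ℂ] H) (E : Submodule ℂ H)
    [E.HasOrthogonalProjection] : ‖T ∘L E.starProjection - T‖ ≤ restrNorm T E := by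
  refine ContinuousLinearMap.opNorm_le_bound _ (restrNorm_nonneg T E) fun x => ?_
  have h : (T ∘L E.starProjection - T) x = -T (Eᗮ.starProjection x) := by
    rw [E.starProjection_orthogonal_val, map_sub, neg_sub]
    rfl
  rw [h, norm_neg]
  exact (norm_apply_le_restrNorm T E (Eᗮ.starProjection_apply_mem x)).trans
    (mul_le_mul_of_nonneg_left (Eᗮ.norm_starProjection_apply_le x) (restrNorm_nonneg T E))

variable {b : HilbertBasis ℕ ℂ H}

theorem mu_le_of_isDiagonal {T : H →L[ℂ] H} {d : ℕ → ℂ} (hT : IsDiagonal b d T) {k : ℕ} {c : ℝ}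
    (hd : ∀ i, k ≤ i → ‖d i‖ ≤ c) : mu T k ≤ c := by
  let E : Submodule ℂ H := Submodule.span ℂ (Set.range fun i : Fin k => b i)
  have : FiniteDimensional ℂ E := FiniteDimensional.span_of_finite ℂ (Set.finite_range _)
  have hE : Module.finrank ℂ E ≤ k :=
    (finrank_range_le_card (R := ℂ) fun i : Fin k => b i).trans_eq (Fintype.card_fin k)
  have hc : 0 ≤ c := (norm_nonneg _).trans (hd k le_rfl)
  refine (mu_le T E hE).trans (restrNorm_le T E hc fun x hx => hT.norm_apply_le hc fun i => ?_)
  rcases lt_or_ge i k with hi | hi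
  · exact Or.inr ((Submodule.mem_orthogonal _ _).1 hx _ (Submodule.subset_span ⟨⟨i, hi⟩, rfl⟩))
  · exact Or.inl (hd i hi)

variable [CompleteSpace H]

theorem isCompactOperator_of_tendsto_mu {T : H →L[ℂ] H} (hT : Tendsto (mu T) atTop (𝓝 0)) :
    IsCompactOperator T := by
  choose E hfin _ hE using fun k : ℕ => exists_restrNorm_lt T k (Nat.one_div_pos_of_nat (α := ℝ))
  refine isCompactOperator_of_tendsto (l := atTop) (F := fun k => T ∘L (E k).starProjection) ?_
    (Eventually.of_forall fun k => ?_)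
  · rw [tendsto_iff_norm_sub_tendsto_zero]
    refine squeeze_zero (fun _ => norm_nonneg _)
      (fun k => (norm_comp_starProjection_sub_le T (E k)).trans (hE k).le) ?_
    simpa using hT.add tendsto_one_div_add_atTop_nhds_zero_nat
  · have : ProperSpace (E k) := FiniteDimensional.proper ℂ (E k)
    have h : IsCompactOperator (E k).orthogonalProjectionOnto :=
      isCompactOperator_of_locallyCompactSpace_dom _
    exact h.clm_comp (T ∘L (E k).subtypeL)

theorem mem_weakTraceClass_of_mu_le {T : H →L[ℂ] H} {C : ℝ}
    (hT : ∀ k : ℕ, mu T k ≤ C / (k + 1)) : T ∈ weakTraceClass H := by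
  refine ⟨isCompactOperator_of_tendsto_mu (squeeze_zero (mu_nonneg T) hT ?_), C, hT⟩
  simpa [Function.comp_def] using
    (tendsto_const_div_atTop_nhds_zero_nat C).comp (tendsto_add_atTop_nat 1)

theorem mem_weakTraceClass_of_isDiagonal {T : H →L[ℂ] H} {d : ℕ → ℂ} (hT : IsDiagonal b d T)
    {C : ℝ} (hd : ∀ m : ℕ, ‖d m‖ ≤ C / (m + 1)) : T ∈ weakTraceClass H := by
  have hC : 0 ≤ C := by simpa using (norm_nonneg _).trans (hd 0)
  exact mem_weakTraceClass_of_mu_le fun k =>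
    mu_le_of_isDiagonal hT fun i hi => (hd i).trans (by gcongr)

variable (b)

theorem exists_weakTraceClass_isDiagonal {d : ℕ → ℂ} {C : ℝ} (hd : ∀ m : ℕ, ‖d m‖ ≤ C / (m + 1)) :
    ∃ T : weakTraceClass H, IsDiagonal b d T := by
  have hC : 0 ≤ C := by simpa using (norm_nonneg _).trans (hd 0)
  obtain ⟨T, hT⟩ := exists_isDiagonal b fun m => (hd m).trans (div_le_self hC (by simp))
  exact ⟨⟨T, mem_weakTraceClass_of_isDiagonal hT hd⟩, hT⟩

theorem exists_weakTraceClass_isDiagonal_harmonic :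
    ∃ T : weakTraceClass H, IsDiagonal b (fun m => (((m : ℝ) + 1)⁻¹ : ℝ)) T :=
  exists_weakTraceClass_isDiagonal b (C := 1) fun m => by
    rw [Complex.norm_real, Real.norm_of_nonneg (by positivity), one_div]

theorem exists_weakTraceClass_isDiagonal_of_finite_support {d : ℕ → ℂ} (hd : d.support.Finite) :
    ∃ T : weakTraceClass H, IsDiagonal b d T := by
  refine exists_weakTraceClass_isDiagonal b (C := ∑ m ∈ hd.toFinset, ‖d m‖ * (m + 1)) fun m => ?_
  rw [le_div_iff₀ (by positivity)]
  by_cases hm : d m = 0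
  · rw [hm, norm_zero, zero_mul]
    positivity
  · exact Finset.single_le_sum (f := fun m : ℕ => ‖d m‖ * (m + 1)) (fun _ _ => by positivity)
      (hd.mem_toFinset.2 hm)

theorem exists_weakTraceClass_isDiagonal_single (j : ℕ) :
    ∃ T : weakTraceClass H, IsDiagonal b (Pi.single j 1) T :=
  exists_weakTraceClass_isDiagonal_of_finite_support b
    ((Set.finite_singleton j).subset Pi.support_single_subset)

/-- The linear functional `A ↦ φ(AT)` on the bounded operators. -/
def traceAgainst (φ : weakTraceClass H →ₗ[ℂ] ℂ) (T : weakTraceClass H) :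
    (H →L[ℂ] H) →ₗ[ℂ] ℂ where
  toFun A := φ ⟨A ∘L (T : H →L[ℂ] H), comp_left_mem A T.2⟩
  map_add' A B := by
    rw [← map_add]
    exact congrArg φ (Subtype.ext (ContinuousLinearMap.add_comp A B _))
  map_smul' c A := by
    rw [← map_smul]
    exact congrArg φ (Subtype.ext (ContinuousLinearMap.smul_comp c A _))

theorem traceAgainst_one (φ : weakTraceClass H →ₗ[ℂ] ℂ) (T : weakTraceClass H) :
    traceAgainst φ T 1 = φ T := rfl

namespace IsNormalizedPositiveTrace

variable {φ : weakTraceClass H →ₗ[ℂ] ℂ}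

theorem map_comp_comm (hφ : IsNormalizedPositiveTrace φ) (A : H →L[ℂ] H) (T : weakTraceClass H) :
    φ ⟨A ∘L (T : H →L[ℂ] H), comp_left_mem A T.2⟩ =
      φ ⟨(T : H →L[ℂ] H) ∘L A, comp_right_mem A T.2⟩ := by
  rw [← sub_eq_zero, ← map_sub]
  exact hφ.map_commutator A T

theorem map_conj (hφ : IsNormalizedPositiveTrace φ) {A B : H →L[ℂ] H} (hBA : B ∘L A = 1)
    {S T : weakTraceClass H} (h : (S : H →L[ℂ] H) = A ∘L (T : H →L[ℂ] H) ∘L B) : φ S = φ T := by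
  have hS : S = ⟨_, comp_left_mem A (comp_right_mem B T.2)⟩ := Subtype.ext h
  have hT : ((T : H →L[ℂ] H) ∘L B) ∘L A = T := by
    rw [ContinuousLinearMap.comp_assoc, hBA]
    rfl
  rw [hS, hφ.map_comp_comm A ⟨(T : H →L[ℂ] H) ∘L B, comp_right_mem B T.2⟩]
  exact congrArg φ (Subtype.ext hT)

theorem map_eq_zero_of_conj_eq_smul (hφ : IsNormalizedPositiveTrace φ) {A B : H →L[ℂ] H}
    (hBA : B ∘L A = 1) {T : weakTraceClass H} {c : ℂ} (hc : c ≠ 1)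
    (h : A ∘L (T : H →L[ℂ] H) ∘L B = c • (T : H →L[ℂ] H)) : φ T = 0 := by
  have h' : c * φ T = φ T := by
    rw [← smul_eq_mul, ← map_smul]
    exact hφ.map_conj hBA h.symm
  exact (mul_left_eq_self₀.1 h').resolve_left hc

theorem mono (hφ : IsNormalizedPositiveTrace φ) {S T : weakTraceClass H}
    (h : ((T : H →L[ℂ] H) - S).IsPositive) : φ S ≤ φ T := by
  rw [← sub_nonneg, ← map_sub]
  exact hφ.nonneg _ h

theorem continuous_traceAgainst (hφ : IsNormalizedPositiveTrace φ) {T : weakTraceClass H}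
    (hT : (T : H →L[ℂ] H).IsPositive) : Continuous (traceAgainst φ T) := by
  refine map_continuous (PositiveLinearMap.mk₀ (traceAgainst φ T) fun A hA => ?_)
  obtain ⟨B, rfl⟩ := CStarAlgebra.nonneg_iff_eq_star_mul_self.1 hA
  have h : traceAgainst φ T (star B * B) =
      φ ⟨(B ∘L (T : H →L[ℂ] H)) ∘L star B, comp_right_mem _ (comp_left_mem B T.2)⟩ :=
    hφ.map_comp_comm (star B) ⟨B ∘L (T : H →L[ℂ] H), comp_left_mem B T.2⟩
  rw [h]
  exact hφ.nonneg _ (hT.conj_adjoint B)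

theorem map_eq_of_isDiagonal (hφ : IsNormalizedPositiveTrace φ) {ι : Type*}
    {b b' : HilbertBasis ι ℂ H} {S T : weakTraceClass H} {d : ι → ℂ} (hS : IsDiagonal b d S)
    (hT : IsDiagonal b' d T) : φ S = φ T := by
  classical
  let e : H ≃L[ℂ] H := (b'.repr.trans b.repr.symm).toContinuousLinearEquiv
  have he : ∀ i, e (b' i) = b i := fun i => by simp [e, b'.repr_self]
  have he' : ∀ i, e.symm (b i) = b' i := fun i => by rw [← he, e.symm_apply_apply]
  refine hφ.map_conj (A := (e : H →L[ℂ] H)) (B := (e.symm : H →L[ℂ] H)) (by ext x; simp) ?_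
  exact clm_eq_of_eqOn_hilbertBasis b fun i => by simp [hS i, he, he', hT i]

variable {b}

theorem map_harmonic (hφ : IsNormalizedPositiveTrace φ) {T : weakTraceClass H}
    (hT : IsDiagonal b (fun m => (((m : ℝ) + 1)⁻¹ : ℝ)) T) : φ T = 1 := by
  obtain ⟨T₀, ⟨ξ, hξ⟩, hT₀⟩ := hφ.normalized
  rw [← hT₀]
  exact hφ.map_eq_of_isDiagonal hT fun m => by simpa using hξ m

theorem map_single_eq_map_single (hφ : IsNormalizedPositiveTrace φ) {i j : ℕ}
    {S T : weakTraceClass H} (hS : IsDiagonal b (Pi.single i 1) S)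
    (hT : IsDiagonal b (Pi.single j 1) T) : φ S = φ T := by
  refine hφ.map_eq_of_isDiagonal (hS.reindex (Equiv.swap j i)) (b' := b) ?_
  convert hT using 2 with k
  simp only [Pi.single_apply, Equiv.swap_apply_eq_iff, Equiv.swap_apply_right]

theorem sum_one_div_mul_map_single_le (hφ : IsNormalizedPositiveTrace φ) {j : ℕ}
    {T : weakTraceClass H} (hT : IsDiagonal b (Pi.single j 1) T) (M : ℕ) :
    (∑ m ∈ Finset.range M, 1 / ((m : ℂ) + 1)) * φ T ≤ 1 := by
  choose p hp using exists_weakTraceClass_isDiagonal_single b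
  obtain ⟨T₀, hT₀⟩ := exists_weakTraceClass_isDiagonal_harmonic b
  have hle : φ (∑ m ∈ Finset.range M, (1 / ((m : ℂ) + 1)) • p m) ≤ φ T₀ := by
    refine hφ.mono ?_
    simp only [Submodule.coe_sum, Submodule.coe_smul]
    refine (hT₀.sub (IsDiagonal.sum (fun m => (hp m).smul (1 / ((m : ℂ) + 1))) _)).isPositive
      fun i => ?_
    have hi : (0 : ℂ) ≤ (((i : ℝ) + 1)⁻¹ : ℝ) := Complex.zero_le_real.2 (by positivity)
    simp only [Pi.single_apply, mul_ite, mul_one, mul_zero, Finset.sum_ite_eq, Finset.mem_range]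
    split_ifs
    · simp
    · simpa using hi
  simpa only [map_sum, map_smul, hφ.map_single_eq_map_single (hp _) hT, hφ.map_harmonic hT₀,
    smul_eq_mul, ← Finset.sum_mul] using hle

theorem map_single (hφ : IsNormalizedPositiveTrace φ) {j : ℕ} {T : weakTraceClass H}
    (hT : IsDiagonal b (Pi.single j 1) T) : φ T = 0 := by
  have h0 : 0 ≤ φ T := hφ.nonneg T (hT.isPositive (Pi.single_nonneg.2 zero_le_one))
  by_contra hne
  have hpos : 0 < ‖φ T‖ := norm_pos_iff.2 hne
  obtain ⟨M, hM⟩ := (Real.tendsto_sum_range_one_div_nat_succ_atTop.eventually_gt_atTop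
    (1 / ‖φ T‖)).exists
  have hle := hφ.sum_one_div_mul_map_single_le hT M
  rw [Complex.eq_coe_norm_of_nonneg h0] at hle
  rw [div_lt_iff₀ hpos] at hM
  exact hM.not_ge (Complex.real_le_real.1 (by push_cast; exact hle))

theorem map_eq_zero_of_finite_support (hφ : IsNormalizedPositiveTrace φ) {T : weakTraceClass H}
    {d : ℕ → ℂ} (hT : IsDiagonal b d T) (hd : d.support.Finite) : φ T = 0 := by
  choose p hp using exists_weakTraceClass_isDiagonal_single b
  have h : T = ∑ m ∈ hd.toFinset, d m • p m := by
    refine Subtype.ext (hT.unique ?_)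
    simp only [Submodule.coe_sum, Submodule.coe_smul]
    convert IsDiagonal.sum (fun m => (hp m).smul (d m)) hd.toFinset using 2 with i
    simp [Pi.single_apply]
  simp [h, hφ.map_single (hp _)]

theorem map_le_of_eventually_le (hφ : IsNormalizedPositiveTrace φ) {T : weakTraceClass H}
    {d : ℕ → ℝ} (hT : IsDiagonal b (fun m => (d m : ℂ)) T) {c : ℝ}
    (hc : ∀ᶠ m : ℕ in atTop, ((m : ℝ) + 1) * d m ≤ c) : φ T ≤ c := by
  have hpos : ∀ m : ℕ, (0 : ℝ) < (m : ℝ) + 1 := fun m => by positivity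
  let r : ℕ → ℝ := fun m => max 0 (d m - c * ((m : ℝ) + 1)⁻¹)
  have hr : (fun m => (r m : ℂ)).support.Finite := by
    rw [← Nat.cofinite_eq_atTop, eventually_cofinite] at hc
    refine hc.subset fun m hm hle => hm ?_
    rw [Complex.ofReal_eq_zero]
    refine max_eq_left (sub_nonpos.2 ?_)
    rwa [← div_eq_mul_inv, le_div_iff₀ (hpos m), mul_comm]
  obtain ⟨T₀, hT₀⟩ := exists_weakTraceClass_isDiagonal_harmonic b
  obtain ⟨R, hR⟩ := exists_weakTraceClass_isDiagonal_of_finite_support b hr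
  have hle : φ T ≤ φ ((c : ℂ) • T₀ + R) := by
    refine hφ.mono ((((hT₀.smul (c : ℂ)).add hR).sub hT).isPositive fun m => ?_)
    have := le_max_right 0 (d m - c * ((m : ℝ) + 1)⁻¹)
    exact_mod_cast (by linarith : 0 ≤ c * ((m : ℝ) + 1)⁻¹ + r m - d m)
  simpa [hφ.map_harmonic hT₀, hφ.map_eq_zero_of_finite_support hR hr] using hle

theorem map_eq_of_tendsto (hφ : IsNormalizedPositiveTrace φ) {T : weakTraceClass H} {d : ℕ → ℝ}
    (hT : IsDiagonal b (fun m => (d m : ℂ)) T) {L : ℝ}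
    (hL : Tendsto (fun m : ℕ => ((m : ℝ) + 1) * d m) atTop (𝓝 L)) : φ T = L := by
  have h_upper : ∀ ε : ℝ, 0 < ε → φ T ≤ ((L + ε : ℝ) : ℂ) := fun ε hε =>
    hφ.map_le_of_eventually_le hT (hL.eventually_le_const (by linarith))
  have h_lower : ∀ ε : ℝ, 0 < ε → φ (-T) ≤ ((-L + ε : ℝ) : ℂ) := fun ε hε =>
    hφ.map_le_of_eventually_le (b := b) (d := fun m => -d m) (fun m => by simp [hT m])
      (by simpa using hL.neg.eventually_le_const (show -L < -L + ε by linarith))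
  refine Complex.ext (le_antisymm (le_of_forall_pos_le_add fun ε hε => ?_)
    (le_of_forall_pos_le_add fun ε hε => ?_)) ?_
  · exact (Complex.le_def.1 (h_upper ε hε)).1
  · have := (Complex.le_def.1 (h_lower ε hε)).1
    simp only [map_neg, Complex.neg_re, Complex.ofReal_re] at this ⊢
    linarith
  · simpa using (Complex.le_def.1 (h_upper 1 one_pos)).2

end IsNormalizedPositiveTrace

end WeakTrace

section Sorting

variable {ι : Type*}

theorem nonempty_orderIso_nat [LinearOrder ι] [Infinite ι] (h : ∀ i : ι, (Set.Iio i).Finite) :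
    Nonempty (ℕ ≃o ι) := by
  have hr : StrictMono fun i : ι => (Set.Iio i).ncard := fun _ j hij =>
    Set.ncard_lt_ncard (Set.Iio_ssubset_Iio hij) (h j)
  have : Infinite (Set.range fun i : ι => (Set.Iio i).ncard) :=
    (Set.infinite_range_of_injective hr.injective).to_subtype
  classical
  exact ⟨(Nat.Subtype.orderIsoOfNat _).trans hr.orderIso.symm⟩

theorem finite_setOf_le_of_tendsto_cofinite {ρ : ι → ℝ} (hρ : Tendsto ρ cofinite atTop) (c : ℝ) :
    {i | ρ i ≤ c}.Finite := by
  simpa only [not_lt] using eventually_cofinite.1 (hρ.eventually_gt_atTop c)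

theorem exists_equiv_nat_monotone [Countable ι] [Infinite ι] {ρ : ι → ℝ}
    (hρ : Tendsto ρ cofinite atTop) : ∃ σ : ℕ ≃ ι, Monotone (ρ ∘ σ) := by
  obtain ⟨encode, h_encode⟩ := Countable.exists_injective_nat ι
  -- Ties between equal values are broken by an enumeration of `ι`.
  let key : ι → ℝ ×ₗ ℕ := fun i => toLex (ρ i, encode i)
  have h_key : Function.Injective key := fun i j h =>
    h_encode (congrArg Prod.snd (toLex.injective h))
  let _ : LinearOrder ι := LinearOrder.lift' key h_key
  have h_mono : Monotone ρ := fun i j hij => by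
    rcases Prod.Lex.le_iff.1 (show key i ≤ key j from hij) with h | h
    · exact h.le
    · exact h.1.le
  obtain ⟨σ⟩ := nonempty_orderIso_nat fun i : ι =>
    (finite_setOf_le_of_tendsto_cofinite hρ (ρ i)).subset fun j hj => h_mono (le_of_lt hj)
  exact ⟨σ.toEquiv, h_mono.comp σ.monotone⟩

theorem succ_le_ncard_setOf_le {a : ℕ → ℝ} (ha : Monotone a) {c : ℝ} {m : ℕ}
    (hfin : {j | a j ≤ c}.Finite) (hc : a m ≤ c) : m + 1 ≤ {j | a j ≤ c}.ncard := by
  have h : (Finset.range (m + 1) : Set ℕ) ⊆ {j | a j ≤ c} := fun j hj =>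
    (ha (Nat.lt_succ_iff.1 (Finset.mem_range.1 hj))).trans hc
  simpa using Set.ncard_le_ncard h hfin

theorem ncard_setOf_le_le {a : ℕ → ℝ} (ha : Monotone a) {c : ℝ} {m : ℕ} (hc : c < a m) :
    {j | a j ≤ c}.ncard ≤ m := by
  have h : {j | a j ≤ c} ⊆ (Finset.range m : Set ℕ) := fun j hj =>
    Finset.mem_coe.2 (Finset.mem_range.2 (ha.reflect_lt (lt_of_le_of_lt hj hc)))
  simpa using Set.ncard_le_ncard h (Finset.finite_toSet _)

theorem tendsto_succ_div_of_tendsto_ncard_div {a : ℕ → ℝ} (ha : Monotone a)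
    (h_top : Tendsto a atTop atTop) {V : ℝ}
    (hV : Tendsto (fun c : ℝ => ({j | a j ≤ c}.ncard : ℝ) / c) atTop (𝓝 V)) :
    Tendsto (fun m : ℕ => ((m : ℝ) + 1) / a m) atTop (𝓝 V) := by
  have hfin := finite_setOf_le_of_tendsto_cofinite (Nat.cofinite_eq_atTop ▸ h_top)
  have h_lower : Tendsto (fun m => ({j | a j ≤ a m - 1}.ncard : ℝ) / (a m - 1) *
      (1 - (a m)⁻¹)) atTop (𝓝 V) := by
    have h1 := hV.comp (tendsto_atTop_add_const_right _ (-1) h_top)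
    have h2 := (tendsto_inv_atTop_zero.comp h_top).const_sub 1
    simpa only [Function.comp_def, ← sub_eq_add_neg, sub_zero, mul_one] using h1.mul h2
  refine tendsto_of_tendsto_of_tendsto_of_le_of_le' h_lower (hV.comp h_top) ?_ ?_
  · filter_upwards [h_top.eventually_gt_atTop 1] with m hm
    have h_ne : a m - 1 ≠ 0 := (sub_pos.2 hm).ne'
    have h_card : ({j | a j ≤ a m - 1}.ncard : ℝ) ≤ m := by
      exact_mod_cast ncard_setOf_le_le ha (sub_one_lt (a m))
    calc _ = ({j | a j ≤ a m - 1}.ncard : ℝ) / a m := by field_simp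
      _ ≤ _ := by gcongr; linarith
  · filter_upwards [h_top.eventually_gt_atTop 0] with m hm
    have h_card : (m : ℝ) + 1 ≤ {j | a j ≤ a m}.ncard := by
      exact_mod_cast succ_le_ncard_setOf_le ha (hfin _) le_rfl
    exact div_le_div_of_nonneg_right h_card hm.le

theorem exists_equiv_nat_tendsto_succ_div [Countable ι] [Infinite ι] {ρ : ι → ℝ}
    (hρ : Tendsto ρ cofinite atTop) {V : ℝ}
    (hV : Tendsto (fun c : ℝ => ({i | ρ i ≤ c}.ncard : ℝ) / c) atTop (𝓝 V)) :
    ∃ σ : ℕ ≃ ι, Tendsto (fun m : ℕ => ((m : ℝ) + 1) / ρ (σ m)) atTop (𝓝 V) := by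
  obtain ⟨σ, hσ⟩ := exists_equiv_nat_monotone hρ
  refine ⟨σ, tendsto_succ_div_of_tendsto_ncard_div hσ
    (hρ.comp (Nat.cofinite_eq_atTop ▸ σ.injective.tendsto_cofinite)) (hV.congr fun c => ?_)⟩
  congr 2
  exact (Set.ncard_preimage_of_injective_subset_range σ.injective
    (by rw [σ.range_eq_univ]; exact Set.subset_univ _)).symm

end Sorting

section LatticePoints

theorem coe_span_piBasisFun {ι : Type*} [Finite ι] :
    (Submodule.span ℤ (Set.range (Pi.basisFun ℝ ι)) : Set (ι → ℝ)) =
      Set.range fun (k : ι → ℤ) (j : ι) => (k j : ℝ) := by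
  ext x
  simp only [SetLike.mem_coe, Module.Basis.mem_span_iff_repr_mem, Pi.basisFun_repr, Set.mem_range,
    algebraMap_int_eq, Int.coe_castRingHom, funext_iff, Classical.skolem]

variable {ι : Type*} [Fintype ι]

theorem covolume_span_piBasisFun :
    ZLattice.covolume (Submodule.span ℤ (Set.range (Pi.basisFun ℝ ι))) = 1 := by
  classical
  rw [ZLattice.covolume_eq_measure_fundamentalDomain _ _
    (ZSpan.isAddFundamentalDomain (Pi.basisFun ℝ ι) volume),
    ZSpan.fundamentalDomain_pi_basisFun, measureReal_def, Real.volume_pi_Ico]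
  simp

theorem tendsto_ncard_int_le_div [Nonempty ι] {F : (ι → ℝ) → ℝ}
    (h_smul : ∀ x ⦃r : ℝ⦄, 0 ≤ r → F (r • x) = r ^ Fintype.card ι * F x)
    (h_bdd : Bornology.IsBounded {x | F x ≤ 1}) (h_meas : MeasurableSet {x | F x ≤ 1})
    (h_frontier : volume (frontier {x | F x ≤ 1}) = 0) :
    Tendsto (fun c : ℝ => ({k : ι → ℤ | F (fun j => k j) ≤ c}.ncard : ℝ) / c) atTop
      (𝓝 (volume.real {x | F x ≤ 1})) := by
  have h := ZLattice.covolume.tendsto_card_le_div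
    (Submodule.span ℤ (Set.range (Pi.basisFun ℝ ι))) (X := Set.univ) (F := F)
    (fun _ _ _ _ => Set.mem_univ _) h_smul (by simpa using h_bdd) (by simpa using h_meas)
    (by simpa using h_frontier)
  simp only [Set.mem_univ, true_and, covolume_span_piBasisFun, div_one, coe_span_piBasisFun,
    ← Set.image_preimage_eq_inter_range] at h
  have h_inj : Function.Injective fun (k : ι → ℤ) (j : ι) => (k j : ℝ) := fun _ _ hkl =>
    funext fun j => Int.cast_injective (congrFun hkl j)
  refine h.congr fun c => ?_
  rw [Nat.card_coe_set_eq, Set.ncard_image_of_injective _ h_inj]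
  rfl

theorem tendsto_ncard_norm_pow_le_div [Nonempty ι] :
    Tendsto (fun c : ℝ => ({k : ι → ℤ |
      ‖WithLp.toLp 2 fun j => (k j : ℝ)‖ ^ Fintype.card ι ≤ c}.ncard : ℝ) / c) atTop
      (𝓝 (volume.real (Metric.ball (0 : EuclideanSpace ℝ ι) 1))) := by
  have h_ball : {x : ι → ℝ | ‖WithLp.toLp 2 x‖ ^ Fintype.card ι ≤ 1} =
      WithLp.toLp 2 ⁻¹' Metric.closedBall (0 : EuclideanSpace ℝ ι) 1 := by
    ext x
    simp only [Set.mem_ofPred_eq, Set.mem_preimage, mem_closedBall_zero_iff,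
      pow_le_one_iff_of_nonneg (norm_nonneg _) Fintype.card_ne_zero]
  have h_vol : volume.real (WithLp.toLp 2 ⁻¹' Metric.closedBall (0 : EuclideanSpace ℝ ι) 1) =
      volume.real (Metric.ball (0 : EuclideanSpace ℝ ι) 1) := by
    rw [(PiLp.volume_preserving_toLp ι).measureReal_preimage
      measurableSet_closedBall.nullMeasurableSet, measureReal_def, measureReal_def,
      Measure.addHaar_closedBall_eq_addHaar_ball]
  rw [← h_vol, ← h_ball]
  refine tendsto_ncard_int_le_div
    (F := fun x => ‖WithLp.toLp 2 x‖ ^ Fintype.card ι) (fun x r hr => ?_) ?_ ?_ ?_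
  · simp only [WithLp.toLp_smul, norm_smul, Real.norm_of_nonneg hr, mul_pow]
  · rw [h_ball]
    exact (EuclideanSpace.equiv ι ℝ).symm.antilipschitz.isBounded_preimage
      Metric.isBounded_closedBall
  · rw [h_ball]
    exact measurableSet_closedBall.preimage (PiLp.continuous_toLp 2 _).measurable
  · rw [h_ball]
    exact ((convex_closedBall 0 1).linear_preimage
      (EuclideanSpace.equiv ι ℝ).symm.toLinearMap).addHaar_frontier volume

/-- The eigenvalue `|k|²` of the flat Laplacian at the Weyl unitary of frequency `k`. -/
def laplaceEigenvalue (k : ι → ℤ) : ℝ := ∑ j, (k j : ℝ) ^ 2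

theorem laplaceEigenvalue_nonneg (k : ι → ℤ) : 0 ≤ laplaceEigenvalue k :=
  Finset.sum_nonneg fun _ _ => sq_nonneg _

theorem tendsto_laplaceEigenvalue_cofinite :
    Tendsto (laplaceEigenvalue (ι := ι)) cofinite atTop := by
  classical
  refine tendsto_atTop.2 fun c => eventually_cofinite.2 ?_
  refine (Set.finite_Icc (fun _ => -⌈c⌉) fun _ => ⌈c⌉).subset fun k hk => ?_
  have h_abs (j : ι) : |k j| ≤ ⌈c⌉ := by
    have h_sq : (k j : ℝ) ^ 2 ≤ laplaceEigenvalue k :=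
      Finset.single_le_sum (f := fun j => (k j : ℝ) ^ 2) (fun _ _ => sq_nonneg _)
        (Finset.mem_univ j)
    have h_int : (|k j| : ℝ) ≤ (k j : ℝ) ^ 2 := by
      exact_mod_cast (Int.le_self_sq |k j|).trans_eq (sq_abs _)
    exact_mod_cast (h_int.trans h_sq).trans ((not_le.1 hk).le.trans (Int.le_ceil c))
  exact ⟨fun j => (abs_le.1 (h_abs j)).1, fun j => (abs_le.1 (h_abs j)).2⟩

theorem laplaceEigenvalue_rpow_half_card (k : ι → ℤ) :
    laplaceEigenvalue k ^ ((Fintype.card ι : ℝ) / 2) =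
      ‖WithLp.toLp 2 fun j => (k j : ℝ)‖ ^ Fintype.card ι := by
  have h_sq : laplaceEigenvalue k = ‖WithLp.toLp 2 fun j => (k j : ℝ)‖ ^ 2 :=
    (EuclideanSpace.real_norm_sq_eq (WithLp.toLp 2 fun j => (k j : ℝ))).symm
  rw [h_sq, ← Real.rpow_natCast, ← Real.rpow_mul (norm_nonneg _), Nat.cast_ofNat,
    mul_div_cancel₀ _ (two_ne_zero' ℝ), Real.rpow_natCast]

theorem exists_equiv_nat_tendsto_mul_laplaceEigenvalue_rpow [Nonempty ι] :
    ∃ σ : ℕ ≃ (ι → ℤ), Tendsto (fun m : ℕ =>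
      ((m : ℝ) + 1) * laplaceEigenvalue (σ m) ^ (-((Fintype.card ι : ℝ) / 2))) atTop
      (𝓝 (volume.real (Metric.ball (0 : EuclideanSpace ℝ ι) 1))) := by
  have h_card := tendsto_ncard_norm_pow_le_div (ι := ι)
  simp only [← laplaceEigenvalue_rpow_half_card] at h_card
  obtain ⟨σ, hσ⟩ := exists_equiv_nat_tendsto_succ_div
    ((tendsto_rpow_atTop (by positivity)).comp tendsto_laplaceEigenvalue_cofinite) h_card
  refine ⟨σ, hσ.congr fun m => ?_⟩
  rw [Real.rpow_neg (laplaceEigenvalue_nonneg _), div_eq_mul_inv]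
  rfl

end LatticePoints

theorem volume_real_ball_eq_sphereArea_div {n : ℕ} (hn : n ≠ 0) :
    volume.real (Metric.ball (0 : EuclideanSpace ℝ (Fin n)) 1) = sphereArea n / n := by
  rw [sphereArea, Measure.toSphere_real_apply_univ, finrank_euclideanSpace_fin,
    mul_div_cancel_left₀ _ (Nat.cast_ne_zero.2 hn)]

section NegPower

variable {V H ι : Type*} [AddCommGroup V] [Module ℂ V] [NormedAddCommGroup H]
  [InnerProductSpace ℂ H]

/-- The Hilbert basis `b` diagonalizes the operator `D` with domain `V`, mapped to `H` by `j`: the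
basis vector `b i` is in the domain and is an eigenvector for the real eigenvalue `ev i`, and `D`
multiplies the `i`-th coefficient of every vector of its domain by `ev i`. -/
structure IsEigenbasis (D : Module.End ℂ V) (j : V →ₗ[ℂ] H) (b : HilbertBasis ι ℂ H)
    (ev : ι → ℝ) : Prop where
  mem_map_eigenspace : ∀ i, b i ∈ (D.eigenspace (ev i : ℂ)).map j
  inner_map_apply : ∀ i u, ⟪b i, j (D u)⟫_ℂ = (ev i : ℂ) * ⟪b i, j u⟫_ℂ

theorem sum_mul_ite_eq_subtype {α : Type*} {p : α → Prop} [DecidableEq α] (S : Finset (Subtype p))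
    (f : α → ℂ) (x : α) : ∑ μ ∈ S, f μ * (if x = μ then 1 else 0) =
      if x ∈ S.map (.subtype p) then f x else 0 := by
  rw [← Finset.sum_ite_eq (S.map (.subtype p)) x f, Finset.sum_map]
  exact Finset.sum_congr rfl fun μ _ => mul_boole _ _

namespace IsEigenbasis

variable {D : Module.End ℂ V} {j : V →ₗ[ℂ] H} {b : HilbertBasis ι ℂ H} {ev : ι → ℝ}

theorem isDiagonal_starProjection [CompleteSpace H] (h : IsEigenbasis D j b ev) (μ : ℝ) :
    IsDiagonal b (fun i => if ev i = μ then 1 else 0)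
      ((D.eigenspace (μ : ℂ)).map j).topologicalClosure.starProjection := fun i => by
  dsimp only
  split_ifs with hμ
  · rw [one_smul, Submodule.starProjection_eq_self_iff, ← hμ]
    exact Submodule.le_topologicalClosure _ (h.mem_map_eigenspace i)
  · rw [zero_smul, Submodule.starProjection_apply_eq_zero_iff, Submodule.orthogonal_closure,
      Submodule.mem_orthogonal']
    rintro _ ⟨u, hu, rfl⟩
    have h_coeff := h.inner_map_apply i u
    rw [Module.End.mem_eigenspace_iff.1 hu, map_smul, inner_smul_right,
      mul_eq_mul_right_iff] at h_coeff
    exact h_coeff.resolve_left fun h_eq => hμ (Complex.ofReal_injective h_eq).symm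

-- When `ev i = 0` the eigenvalue `0 ^ (-s)` is `0`, in accordance with `D^{-s} = 0` on `ker D`.
theorem isDiagonal_negPower [CompleteSpace H] (h : IsEigenbasis D j b ev) (h_nonneg : ∀ i, 0 ≤ ev i)
    (h_top : Tendsto ev cofinite atTop) {s : ℝ} (hs : 0 < s) :
    IsDiagonal b (fun i => ((ev i ^ (-s) : ℝ) : ℂ)) (NCTorus.negPower D j s) := by
  classical
  have h_zero : Tendsto (fun i => ((ev i ^ (-s) : ℝ) : ℂ)) cofinite (𝓝 0) := by
    simpa only [Complex.ofReal_zero, Function.comp_def] using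
      (Complex.continuous_ofReal.tendsto 0).comp ((tendsto_rpow_neg_atTop hs).comp h_top)
  obtain ⟨C, hC⟩ := h_zero.norm.bddAbove_range_of_cofinite
  obtain ⟨T, hT⟩ := exists_isDiagonal b fun i => hC ⟨i, rfl⟩
  suffices h_sum : HasSum (fun μ : {μ : ℝ // 0 < μ} => (((μ : ℝ) ^ (-s) : ℝ) : ℂ) •
      ((D.eigenspace ((μ : ℝ) : ℂ)).map j).topologicalClosure.starProjection) T by
    rwa [NCTorus.negPower, h_sum.tsum_eq]
  refine IsDiagonal.tendsto (fun S => IsDiagonal.sum (fun μ : {μ : ℝ // 0 < μ} =>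
    (h.isDiagonal_starProjection μ).smul _) S) hT (Metric.tendstoUniformly_iff.2 fun ε hε => ?_)
  have h_large : {i | ε ≤ ‖((ev i ^ (-s) : ℝ) : ℂ)‖}.Finite := by
    simpa only [not_lt, norm_zero] using eventually_cofinite.1 (h_zero.norm.eventually_lt_const
      (norm_zero.trans_lt hε))
  have h_pos {i : ι} (hi : ε ≤ ‖((ev i ^ (-s) : ℝ) : ℂ)‖) : 0 < ev i :=
    (h_nonneg i).lt_of_ne fun h0 => by
      rw [← h0, Real.zero_rpow (neg_ne_zero.2 hs.ne'), Complex.ofReal_zero, norm_zero] at hi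
      exact hε.not_ge hi
  have h_val : (Subtype.val ⁻¹' (ev '' {i | ε ≤ ‖((ev i ^ (-s) : ℝ) : ℂ)‖}) :
    Set {μ : ℝ // 0 < μ}).Finite := (h_large.image ev).preimage Subtype.val_injective.injOn
  filter_upwards [eventually_ge_atTop h_val.toFinset] with S hS i
  rw [sum_mul_ite_eq_subtype S (fun μ => ((μ ^ (-s) : ℝ) : ℂ))]
  split_ifs with hi
  · rwa [dist_self]
  · rw [dist_zero_right]
    refine not_le.1 fun h_le => hi (Finset.mem_map.2 ⟨⟨ev i, h_pos h_le⟩, hS ?_, rfl⟩)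
    exact h_val.mem_toFinset.2 ⟨i, h_le, rfl⟩

end IsEigenbasis

end NegPower

namespace NCTorus

open UnitAddTorus

section Characters

variable {d : Type*} [Fintype d]

theorem mFourier_apply_add (k : d → ℤ) (x t : UnitAddTorus d) :
    mFourier k (x + t) = mFourier k x * mFourier k t := by
  simp [mFourier, fourier_apply, AddCircle.toCircle_add, Finset.prod_mul_distrib]

theorem mFourier_apply_zero (k : d → ℤ) : mFourier k (0 : UnitAddTorus d) = 1 := by
  simp [mFourier, fourier_apply]

theorem mFourier_apply_mul_apply_neg (k : d → ℤ) (t : UnitAddTorus d) :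
    mFourier k t * mFourier k (-t) = 1 := by
  rw [← mFourier_apply_add, add_neg_cancel, mFourier_apply_zero]

theorem norm_mFourier_apply (k : d → ℤ) (x : UnitAddTorus d) : ‖mFourier k x‖ = 1 := by
  rw [mFourier, ContinuousMap.coe_mk, norm_prod]
  exact Finset.prod_eq_one fun _ _ => Circle.norm_coe _

theorem mFourier_apply_ne_zero (k : d → ℤ) (x : UnitAddTorus d) : mFourier k x ≠ 0 :=
  norm_ne_zero_iff.1 ((norm_mFourier_apply k x).trans_ne one_ne_zero)

theorem exists_mFourier_apply_ne_one {k : d → ℤ} (hk : k ≠ 0) :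
    ∃ t : UnitAddTorus d, mFourier k t ≠ 1 := by
  by_contra! h
  have h_eq : mFourier k = mFourier (0 : d → ℤ) := by
    ext t
    rw [h, mFourier_zero, ContinuousMap.one_apply]
  exact hk (orthonormal_mFourier.linearIndependent.injective (by rw [mFourierLp, mFourierLp, h_eq]))

end Characters

variable {n : ℕ}

theorem mFourier_angle (k : Fin n → ℤ) (s : Fin n → ℝ) :
    mFourier k (angle s) = Complex.exp (Complex.I * ∑ j, (k j : ℂ) * s j) := by
  rw [Finset.mul_sum, Complex.exp_sum, mFourier, ContinuousMap.coe_mk]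
  refine Finset.prod_congr rfl fun j _ => ?_
  rw [angle, fourier_coe_apply]
  congr 1
  push_cast
  field_simp

theorem mFourier_angle_smul_single (k : Fin n → ℤ) (j : Fin n) (t : ℝ) :
    mFourier k (angle (t • Pi.single j 1)) = Complex.exp (Complex.I * k j * t) := by
  rw [mFourier_angle, Finset.sum_eq_single j (fun i _ hi => by simp [hi]) (by simp)]
  simp [mul_assoc]

theorem mulOp_comp (f g : C(UnitAddTorus (Fin n), ℂ)) : mulOp f ∘L mulOp g = mulOp (f * g) := by
  ext1 ξ
  apply Lp.ext
  filter_upwards [coeFn_mulOp f (mulOp g ξ), coeFn_mulOp g ξ, coeFn_mulOp (f * g) ξ]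
    with x hf hg hfg
  rw [ContinuousLinearMap.comp_apply, hf, hg, hfg, ContinuousMap.mul_apply, mul_assoc]

theorem mulOp_one : mulOp (1 : C(UnitAddTorus (Fin n), ℂ)) = 1 := by
  ext1 ξ
  apply Lp.ext
  filter_upwards [coeFn_mulOp 1 ξ] with x h
  rw [h, ContinuousMap.one_apply, one_mul]
  rfl

theorem norm_mulOp_mFourier_apply (k : Fin n → ℤ) (ξ : L2 n) : ‖mulOp (mFourier k) ξ‖ = ‖ξ‖ := by
  rw [Lp.norm_def, Lp.norm_def]
  refine congrArg ENNReal.toReal (eLpNorm_congr_norm_ae ?_)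
  filter_upwards [coeFn_mulOp (mFourier k) ξ] with x hx
  rw [hx, norm_mul, norm_mFourier_apply, one_mul]

theorem norm_shift_apply (t : UnitAddTorus (Fin n)) (ξ : L2 n) : ‖shift t ξ‖ = ‖ξ‖ :=
  (Lp.compMeasurePreservingₗᵢ ℂ (fun x => x + t)
    (measurePreserving_add_right (haar n) t)).norm_map ξ

theorem shift_comp_mulOp_mFourier (t : UnitAddTorus (Fin n)) (k : Fin n → ℤ) :
    shift t ∘L mulOp (mFourier k) = mFourier k t • (mulOp (mFourier k) ∘L shift t) := by
  ext1 ξ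
  apply Lp.ext
  have h_translate := (measurePreserving_add_right (haar n) t).quasiMeasurePreserving.ae
    (coeFn_mulOp (mFourier k) ξ)
  filter_upwards [coeFn_shift t (mulOp (mFourier k) ξ), h_translate,
    coeFn_mulOp (mFourier k) (shift t ξ),
    Lp.coeFn_smul (mFourier k t) (mulOp (mFourier k) (shift t ξ)), coeFn_shift t ξ]
    with x h_shift h_mul h_mul_shift h_smul h_shift'
  simp only [ContinuousLinearMap.comp_apply, _root_.smul_apply]
  rw [h_shift, h_mul, h_smul, Pi.smul_apply, h_mul_shift, h_shift', mFourier_apply_add, smul_eq_mul]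
  ring

theorem mulOp_one2 (f : C(UnitAddTorus (Fin n), ℂ)) :
    mulOp f (one2 n) = ContinuousMap.toLp 2 (haar n) ℂ f := by
  apply Lp.ext
  filter_upwards [coeFn_mulOp f (one2 n),
    ContinuousMap.coeFn_toLp (p := 2) (𝕜 := ℂ) (haar n) (1 : C(UnitAddTorus (Fin n), ℂ)),
    ContinuousMap.coeFn_toLp (p := 2) (𝕜 := ℂ) (haar n) f] with x h_mul h_one hf
  rw [h_mul, one2, h_one, hf, ContinuousMap.one_apply, mul_one]

theorem shift_one2 (t : UnitAddTorus (Fin n)) : shift t (one2 n) = one2 n := by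
  apply Lp.ext
  have h_one := ContinuousMap.coeFn_toLp (p := 2) (𝕜 := ℂ) (haar n)
    (1 : C(UnitAddTorus (Fin n), ℂ))
  filter_upwards [coeFn_shift t (one2 n), h_one,
    (measurePreserving_add_right (haar n) t).quasiMeasurePreserving.ae h_one]
    with x h_shift hx hxt
  rw [h_shift, one2, hx, hxt]
  rfl

variable (θ : Matrix (Fin n) (Fin n) ℝ)

/-- The translation part `½ ∑ⱼ kⱼ θⱼ` of the Weyl unitary of frequency `k`, in `𝕋ⁿ = (ℝ/ℤ)ⁿ`. -/
def weylShift (k : Fin n → ℤ) : UnitAddTorus (Fin n) :=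
  ∑ j, k j • (fun l => ((θ l j / 2 : ℝ) : UnitAddCircle))

theorem weylShift_add (k l : Fin n → ℤ) :
    weylShift θ (k + l) = weylShift θ k + weylShift θ l := by
  simp only [weylShift, Pi.add_apply, add_smul, Finset.sum_add_distrib]

theorem weylShift_zero : weylShift θ 0 = 0 := by
  simp [weylShift]

theorem weylShift_single (j : Fin n) :
    weylShift θ (Pi.single j 1) = fun l => ((θ l j / 2 : ℝ) : UnitAddCircle) := by
  rw [weylShift, Finset.sum_eq_single j (fun i _ hi => by rw [Pi.single_eq_of_ne hi, zero_smul])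
    (by simp), Pi.single_eq_same, one_smul]

/-- The Weyl unitary of frequency `k` on `L²(𝕋ⁿ)`: the monomial `U₁^{k₁} ⋯ Uₙ^{kₙ}` up to a phase,
normalized to be a translation followed by multiplication with the character of frequency `k`. -/
def weylOp (k : Fin n → ℤ) : Op n := mulOp (mFourier k) ∘L shift (weylShift θ k)

theorem weylOp_zero : weylOp θ 0 = 1 := by
  rw [weylOp, weylShift_zero, shift_zero, mFourier_zero, mulOp_one]
  rfl

theorem weylOp_single (j : Fin n) : weylOp θ (Pi.single j 1) = U θ j := by
  rw [weylOp, weylShift_single, U]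

theorem weylOp_mul (k l : Fin n → ℤ) :
    weylOp θ k * weylOp θ l = mFourier l (weylShift θ k) • weylOp θ (k + l) := by
  have h_char : mulOp (mFourier (k + l)) = mulOp (mFourier k) ∘L mulOp (mFourier l) := by
    rw [mulOp_comp]
    exact congrArg mulOp (ContinuousMap.ext fun x => mFourier_add)
  calc weylOp θ k * weylOp θ l
      = mulOp (mFourier k) ∘L (shift (weylShift θ k) ∘L mulOp (mFourier l)) ∘L
          shift (weylShift θ l) := rfl
    _ = mFourier l (weylShift θ k) • weylOp θ (k + l) := by
      rw [shift_comp_mulOp_mFourier, weylOp, h_char, weylShift_add, shift_add,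
        ContinuousLinearMap.smul_comp, ContinuousLinearMap.comp_smul]
      rfl

theorem norm_weylOp_apply (k : Fin n → ℤ) (ξ : L2 n) : ‖weylOp θ k ξ‖ = ‖ξ‖ := by
  rw [weylOp, ContinuousLinearMap.comp_apply, norm_mulOp_mFourier_apply, norm_shift_apply]

theorem star_weylOp (k : Fin n → ℤ) :
    star (weylOp θ k) = mFourier k (weylShift θ k) • weylOp θ (-k) := by
  have h_isometry : star (weylOp θ k) * weylOp θ k = 1 := by
    rw [ContinuousLinearMap.star_eq_adjoint]
    exact (ContinuousLinearMap.norm_map_iff_adjoint_comp_self _).1 (norm_weylOp_apply θ k)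
  refine left_inv_eq_right_inv h_isometry ?_
  rw [mul_smul_comm, weylOp_mul, smul_smul, ← mFourier_add, add_neg_cancel, weylOp_zero,
    mFourier_zero, ContinuousMap.one_apply, one_smul]

theorem weylOp_one2 (k : Fin n → ℤ) :
    weylOp θ k (one2 n) = ContinuousMap.toLp 2 (haar n) ℂ (mFourier k) := by
  rw [weylOp, ContinuousLinearMap.comp_apply, shift_one2, mulOp_one2]

theorem weylOp_mem_adjoin (k : Fin n → ℤ) :
    weylOp θ k ∈ StarAlgebra.adjoin ℂ (Set.range (U θ)) := by
  set A := StarAlgebra.adjoin ℂ (Set.range (U θ))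
  have h_phase {c : ℂ} (hc : c ≠ 0) {T : Op n} (hT : c • T ∈ A) : T ∈ A :=
    ((Subalgebra.toSubmodule A.toSubalgebra).smul_mem_iff hc).1 hT
  let G : AddSubgroup (Fin n → ℤ) :=
    { carrier := {k | weylOp θ k ∈ A}
      zero_mem' := by
        rw [Set.mem_ofPred_eq, weylOp_zero]
        exact one_mem A
      add_mem' := fun {k l} (hk : weylOp θ k ∈ A) (hl : weylOp θ l ∈ A) =>
        h_phase (mFourier_apply_ne_zero l (weylShift θ k)) (weylOp_mul θ k l ▸ mul_mem hk hl)
      neg_mem' := fun {k} (hk : weylOp θ k ∈ A) =>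
        h_phase (mFourier_apply_ne_zero k (weylShift θ k)) (star_weylOp θ k ▸ star_mem hk) }
  have hG (j : Fin n) : Pi.single j 1 ∈ G := by
    change weylOp θ (Pi.single j 1) ∈ A
    exact weylOp_single θ j ▸ StarAlgebra.subset_adjoin ℂ _ ⟨j, rfl⟩
  have hk : k = ∑ j, k j • Pi.single j (1 : ℤ) := by
    simp only [← Pi.single_smul, smul_eq_mul, mul_one]
    exact (Finset.univ_sum_single k).symm
  have h_mem : ∑ j, k j • Pi.single j (1 : ℤ) ∈ G := sum_mem fun j _ => zsmul_mem (hG j) _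
  exact hk ▸ h_mem

theorem star_mem_span_weylOp {T : Op n} (hT : T ∈ Submodule.span ℂ (Set.range (weylOp θ))) :
    star T ∈ Submodule.span ℂ (Set.range (weylOp θ)) := by
  induction hT using Submodule.span_induction with
  | mem T hT =>
    obtain ⟨k, rfl⟩ := hT
    exact star_weylOp θ k ▸ Submodule.smul_mem _ _ (Submodule.subset_span ⟨-k, rfl⟩)
  | zero => rw [star_zero]; exact zero_mem _
  | add S T _ _ hS hT => exact star_add S T ▸ add_mem hS hT
  | smul c T _ hT => exact star_smul c T ▸ Submodule.smul_mem _ _ hT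

theorem mul_mem_span_weylOp {S T : Op n} (hS : S ∈ Submodule.span ℂ (Set.range (weylOp θ)))
    (hT : T ∈ Submodule.span ℂ (Set.range (weylOp θ))) :
    S * T ∈ Submodule.span ℂ (Set.range (weylOp θ)) := by
  refine Submodule.mul_le.1 ?_ S hS T hT
  rw [Submodule.span_mul_span, Submodule.span_le]
  rintro _ ⟨_, ⟨k, rfl⟩, _, ⟨l, rfl⟩, rfl⟩
  change weylOp θ k * weylOp θ l ∈ _
  rw [weylOp_mul]
  exact Submodule.smul_mem _ _ (Submodule.subset_span ⟨k + l, rfl⟩)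

theorem adjoin_U_le_span_weylOp :
    (StarAlgebra.adjoin ℂ (Set.range (U θ)) : Set (Op n)) ⊆
      Submodule.span ℂ (Set.range (weylOp θ)) := by
  let A : StarSubalgebra ℂ (Op n) :=
    { (Submodule.span ℂ (Set.range (weylOp θ))).toSubalgebra
        (Submodule.subset_span ⟨0, weylOp_zero θ⟩) fun _ _ => mul_mem_span_weylOp θ with
      star_mem' := star_mem_span_weylOp θ }
  refine StarAlgebra.adjoin_le (S := A) ?_
  rintro _ ⟨j, rfl⟩
  exact Submodule.subset_span ⟨Pi.single j 1, weylOp_single θ j⟩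

/-- The Weyl unitary of frequency `k` as an element of `A_θ`. -/
def weyl (k : Fin n → ℤ) : NCTorus θ :=
  (⟨weylOp θ k, StarSubalgebra.le_topologicalClosure _ (weylOp_mem_adjoin θ k)⟩ : algebraOf θ)

theorem toOp_weyl (k : Fin n → ℤ) : toOp θ (weyl θ k) = weylOp θ k := rfl

theorem toOp_injective : Function.Injective (toOp θ) := Subtype.val_injective

theorem weyl_mul (k l : Fin n → ℤ) :
    weyl θ k * weyl θ l = mFourier l (weylShift θ k) • weyl θ (k + l) := by
  apply toOp_injective
  rw [map_mul, map_smul]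
  exact weylOp_mul θ k l

theorem weyl_zero : weyl θ 0 = 1 := toOp_injective θ (weylOp_zero θ)

theorem dense_span_weyl : Dense (Submodule.span ℂ (Set.range (weyl θ)) : Set (NCTorus θ)) := by
  have h_range : Set.range (weylOp θ) = (toOp θ).toLinearMap '' Set.range (weyl θ) := by
    rw [← Set.range_comp]
    rfl
  have h_le := adjoin_U_le_span_weylOp θ
  rw [h_range, ← Submodule.map_span] at h_le
  exact Subtype.dense_iff.2 fun T hT => closure_mono h_le hT

theorem clm_ext_weyl {E : Type*} [TopologicalSpace E] [AddCommMonoid E] [Module ℂ E] [T2Space E]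
    {S T : NCTorus θ →L[ℂ] E} (h : ∀ k, S (weyl θ k) = T (weyl θ k)) : S = T :=
  ContinuousLinearMap.ext_on (dense_span_weyl θ) (by rintro _ ⟨k, rfl⟩; exact h k)

theorem inner_toHilb (a b : NCTorus θ) :
    ⟪toHilb θ a, toHilb θ b⟫_ℂ = ⟪toOp θ a (one2 n), toOp θ b (one2 n)⟫_ℂ := by
  have h_gns : ⟪toHilb θ a, toHilb θ b⟫_ℂ = ⟪(tau θ).toPreGNS a, (tau θ).toPreGNS b⟫_ℂ :=
    UniformSpace.Completion.inner_coe _ _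
  rw [h_gns, PositiveLinearMap.preGNS_inner_def, PositiveLinearMap.ofPreGNS_toPreGNS,
    PositiveLinearMap.ofPreGNS_toPreGNS]
  change ⟪one2 n, toOp θ (star a * b) (one2 n)⟫_ℂ = _
  rw [map_mul, map_star, mul_apply_eq_comp, ContinuousLinearMap.star_eq_adjoint,
    ContinuousLinearMap.adjoint_inner_right]

theorem leftMul_toHilb (a b : NCTorus θ) : leftMul θ a (toHilb θ b) = toHilb θ (a * b) :=
  PositiveLinearMap.gnsNonUnitalStarAlgHom_apply_coe (tau θ)

theorem continuous_leftMul : Continuous (leftMul θ) :=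
  map_continuous (leftMul θ)

/-- The canonical map `A_θ → ℋ_θ` as a bounded operator. -/
def toHilbL : NCTorus θ →L[ℂ] Hilb θ where
  toLinearMap := toHilb θ
  cont := by
    have h_cyclic : ⇑(toHilb θ) = fun a => leftMul θ a (toHilb θ 1) := by
      funext a
      rw [leftMul_toHilb, mul_one]
    change Continuous (toHilb θ)
    rw [h_cyclic]
    exact (continuous_leftMul θ).clm_apply continuous_const

theorem toHilbL_apply (a : NCTorus θ) : toHilbL θ a = toHilb θ a := rfl

theorem denseRange_toHilbL : DenseRange (toHilbL θ) :=
  UniformSpace.Completion.denseRange_coe (α := (tau θ).PreGNS)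

theorem orthonormal_toHilb_weyl : Orthonormal ℂ fun k => toHilb θ (weyl θ k) := by
  have h := orthonormal_mFourier (d := Fin n)
  rw [orthonormal_iff_ite] at h ⊢
  intro k l
  rw [inner_toHilb, toOp_weyl, toOp_weyl, weylOp_one2, weylOp_one2]
  exact h k l

/-- The orthonormal basis of `ℋ_θ` that consists of the Weyl unitaries. -/
def weylBasis : HilbertBasis (Fin n → ℤ) ℂ (Hilb θ) :=
  HilbertBasis.mk (orthonormal_toHilb_weyl θ) <| by
    have h_range : (Set.range fun k => toHilb θ (weyl θ k)) =
        (toHilbL θ : NCTorus θ →ₗ[ℂ] Hilb θ) '' Set.range (weyl θ) := by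
      rw [← Set.range_comp]
      rfl
    rw [top_le_iff, ← Submodule.dense_iff_topologicalClosure_eq_top, h_range, ← Submodule.map_span]
    exact (denseRange_toHilbL θ).dense_image (toHilbL θ).continuous (dense_span_weyl θ)

theorem weylBasis_apply (k : Fin n → ℤ) : weylBasis θ k = toHilb θ (weyl θ k) := by
  rw [weylBasis, HilbertBasis.coe_mk]

theorem leftMul_weyl_weylBasis (k l : Fin n → ℤ) :
    leftMul θ (weyl θ k) (weylBasis θ l) = mFourier l (weylShift θ k) • weylBasis θ (k + l) := by
  rw [weylBasis_apply, weylBasis_apply, leftMul_toHilb, weyl_mul, map_smul]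

theorem tau_weyl (k : Fin n → ℤ) : tau θ (weyl θ k) = if k = 0 then 1 else 0 := by
  have h_inner : tau θ (weyl θ k) = ⟪weylBasis θ 0, weylBasis θ k⟫_ℂ := by
    rw [weylBasis_apply, weylBasis_apply, inner_toHilb, weyl_zero, map_one]
    rfl
  rw [h_inner, orthonormal_iff_ite.1 (weylBasis θ).orthonormal 0 k]
  exact if_congr eq_comm rfl rfl

theorem alpha_weyl (s : Fin n → ℝ) (k : Fin n → ℤ) :
    alpha θ s (weyl θ k) = mFourier k (angle s) • weyl θ k := by
  apply toOp_injective
  rw [toOp_alpha, map_smul, toOp_weyl, conj_apply, weylOp]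
  change (shift (angle s) ∘L mulOp (mFourier k)) ∘L
    (shift (weylShift θ k) ∘L shift (-angle s)) = _
  rw [shift_comp_mulOp_mFourier, ContinuousLinearMap.smul_comp, ContinuousLinearMap.comp_assoc,
    ← shift_add, ← shift_add, add_neg_cancel_comm_assoc]

theorem weyl_mem_smooth (k : Fin n → ℤ) : weyl θ k ∈ smooth θ := by
  change ContDiff ℝ ∞ fun s : Fin n → ℝ => alpha θ s (weyl θ k)
  simp only [alpha_weyl, mFourier_angle]
  exact ContDiff.smul (ContDiff.cexp (contDiff_const.mul (ContDiff.sum fun j _ =>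
    contDiff_const.mul (Complex.ofRealCLM.contDiff.comp (contDiff_apply ℝ ℝ j))))) contDiff_const

theorem inner_weylBasis_alpha (k : Fin n → ℤ) (s : Fin n → ℝ) (u : NCTorus θ) :
    ⟪weylBasis θ k, toHilb θ (alpha θ s u)⟫_ℂ =
      mFourier k (angle s) * ⟪weylBasis θ k, toHilb θ u⟫_ℂ := by
  suffices h : (innerSL ℂ (weylBasis θ k)) ∘L toHilbL θ ∘L alpha θ s =
      mFourier k (angle s) • ((innerSL ℂ (weylBasis θ k)) ∘L toHilbL θ) from
    DFunLike.congr_fun h u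
  refine clm_ext_weyl θ fun l => ?_
  simp only [ContinuousLinearMap.comp_apply, alpha_weyl, map_smul, toHilbL_apply,
    ← weylBasis_apply, _root_.smul_apply, innerSL_apply_apply,
    orthonormal_iff_ite.1 (weylBasis θ).orthonormal, smul_eq_mul]
  split_ifs with hkl
  · rw [hkl]
  · simp only [mul_zero]

theorem hasDerivAt_alpha_smul_single (j : Fin n) {u : NCTorus θ} (hu : u ∈ smooth θ) :
    HasDerivAt (fun t : ℝ => alpha θ (t • Pi.single j 1) u) (partialAlpha θ j u 0) 0 := by
  have h := (differentiable_alpha θ hu 0).hasFDerivAt.hasLineDerivAt (Pi.single j (1 : ℝ))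
  simpa only [HasLineDerivAt, zero_add] using! h

theorem map_delta {E : Type*} [NormedAddCommGroup E] [NormedSpace ℂ E] (L : NCTorus θ →L[ℂ] E)
    (k : Fin n → ℤ) (u : smooth θ)
    (h : ∀ s, L (alpha θ s u) = mFourier k (angle s) • L u) (j : Fin n) :
    L (delta θ j u) = (k j : ℂ) • L u := by
  have h_alpha : HasDerivAt (fun t : ℝ => L (alpha θ (t • Pi.single j 1) u))
      (L (partialAlpha θ j u 0)) 0 :=
    (L.restrictScalars ℝ).hasFDerivAt.comp_hasDerivAt 0 (hasDerivAt_alpha_smul_single θ j u.2)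
  have h_exp : HasDerivAt (fun t : ℝ => Complex.exp (Complex.I * k j * t)) (Complex.I * k j) 0 := by
    simpa using ((Complex.ofRealCLM.hasDerivAt (x := 0)).const_mul (Complex.I * k j)).cexp
  simp only [h, mFourier_angle_smul_single] at h_alpha
  change L ((1 / Complex.I) • partialAlpha θ j u 0) = _
  rw [map_smul, h_alpha.unique (h_exp.smul_const (L u)), smul_smul, ← mul_assoc,
    one_div_mul_cancel Complex.I_ne_zero, one_mul]

theorem delta_weyl (j : Fin n) (k : Fin n → ℤ) :
    delta θ j ⟨weyl θ k, weyl_mem_smooth θ k⟩ = (k j : ℂ) • ⟨weyl θ k, weyl_mem_smooth θ k⟩ :=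
  Subtype.ext (map_delta θ (.id ℂ _) k ⟨weyl θ k, weyl_mem_smooth θ k⟩
    (fun s => alpha_weyl θ s k) j)

theorem laplacian_weyl (k : Fin n → ℤ) :
    laplacian θ ⟨weyl θ k, weyl_mem_smooth θ k⟩ =
      (laplaceEigenvalue k : ℂ) • ⟨weyl θ k, weyl_mem_smooth θ k⟩ := by
  simp only [laplacian, LinearMap.sum_apply, Module.End.mul_apply, delta_weyl, map_smul, smul_smul,
    ← Finset.sum_smul, laplaceEigenvalue, sq]
  push_cast
  rfl

theorem inner_weylBasis_delta (k : Fin n → ℤ) (j : Fin n) (u : smooth θ) :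
    ⟪weylBasis θ k, toHilb θ (delta θ j u)⟫_ℂ = k j * ⟪weylBasis θ k, toHilb θ u⟫_ℂ :=
  map_delta θ ((innerSL ℂ (weylBasis θ k)) ∘L toHilbL θ) k u
    (fun s => inner_weylBasis_alpha θ k s u) j

theorem inner_weylBasis_laplacian (k : Fin n → ℤ) (u : smooth θ) :
    ⟪weylBasis θ k, toHilb θ (laplacian θ u)⟫_ℂ =
      (laplaceEigenvalue k : ℂ) * ⟪weylBasis θ k, toHilb θ u⟫_ℂ := by
  simp only [laplacian, LinearMap.sum_apply, Module.End.mul_apply, Submodule.coe_sum, map_sum,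
    inner_sum, inner_weylBasis_delta, laplaceEigenvalue, Complex.ofReal_sum, Finset.sum_mul]
  refine Finset.sum_congr rfl fun j _ => ?_
  push_cast
  ring

theorem isEigenbasis_weylBasis :
    IsEigenbasis (laplacian θ) (toHilb θ ∘ₗ (smooth θ).subtype) (weylBasis θ)
      laplaceEigenvalue where
  mem_map_eigenspace k := ⟨⟨weyl θ k, weyl_mem_smooth θ k⟩,
    Module.End.mem_eigenspace_iff.2 (laplacian_weyl θ k), (weylBasis_apply θ k).symm⟩
  inner_map_apply := inner_weylBasis_laplacian θ

open WeakTrace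

variable {φ : weakTraceClass (Hilb θ) →ₗ[ℂ] ℂ}

/-- Conjugation by the unitaries of `ℋ_θ` which implement the translations of `𝕋ⁿ` commutes with `D`
and multiplies the Weyl unitary of frequency `k` by its character. -/
theorem trace_leftMul_weyl_comp_eq_zero (hφ : IsNormalizedPositiveTrace φ)
    {D : weakTraceClass (Hilb θ)} {d : (Fin n → ℤ) → ℂ}
    (hD : IsDiagonal (weylBasis θ) d (D : Hilb θ →L[ℂ] Hilb θ)) {k : Fin n → ℤ} (hk : k ≠ 0) :
    traceAgainst φ D (leftMul θ (weyl θ k)) = 0 := by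
  obtain ⟨t, ht⟩ := exists_mFourier_apply_ne_one hk
  have h_translation (t : UnitAddTorus (Fin n)) :
      ∃ V : Hilb θ →L[ℂ] Hilb θ, IsDiagonal (weylBasis θ) (fun l => mFourier l t) V :=
    exists_isDiagonal (weylBasis θ) fun l => (norm_mFourier_apply l t).le
  obtain ⟨V, hV⟩ := h_translation t
  obtain ⟨W, hW⟩ := h_translation (-t)
  have hWV : W ∘L V = 1 := clm_eq_of_eqOn_hilbertBasis (weylBasis θ) fun l => by
    rw [ContinuousLinearMap.comp_apply, hV, map_smul, hW, smul_smul,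
      mFourier_apply_mul_apply_neg, one_smul]
    rfl
  refine hφ.map_eq_zero_of_conj_eq_smul hWV ht ?_
  refine clm_eq_of_eqOn_hilbertBasis (weylBasis θ) fun l => ?_
  have h_char : mFourier (k + l) t = mFourier k t * mFourier l t := mFourier_add
  simp only [_root_.smul_apply, ContinuousLinearMap.comp_apply, hW l, map_smul, hD l,
    leftMul_weyl_weylBasis, hV (k + l), smul_smul, h_char]
  congr 1
  linear_combination (mFourier k t * d l * mFourier l (weylShift θ k)) *
    mFourier_apply_mul_apply_neg l t

theorem trace_leftMul_comp_eq_mul_tau (hφ : IsNormalizedPositiveTrace φ)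
    {D : weakTraceClass (Hilb θ)} {d : (Fin n → ℤ) → ℂ}
    (hD : IsDiagonal (weylBasis θ) d (D : Hilb θ →L[ℂ] Hilb θ)) (hd : ∀ k, 0 ≤ d k)
    (a : NCTorus θ) : traceAgainst φ D (leftMul θ a) = φ D * tau θ a := by
  let f : NCTorus θ →L[ℂ] ℂ := ⟨traceAgainst φ D ∘ₗ (leftMul θ).toLinearMap,
    (hφ.continuous_traceAgainst (hD.isPositive hd)).comp (continuous_leftMul θ)⟩
  let g : NCTorus θ →L[ℂ] ℂ := ⟨(tau θ).toLinearMap, map_continuous (tau θ)⟩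
  suffices h : f = φ D • g from DFunLike.congr_fun h a
  refine clm_ext_weyl θ fun k => ?_
  change traceAgainst φ D (leftMul θ (weyl θ k)) = φ D * tau θ (weyl θ k)
  rcases eq_or_ne k 0 with rfl | hk
  · rw [tau_weyl, if_pos rfl, mul_one, weyl_zero, map_one, traceAgainst_one]
  · rw [tau_weyl, if_neg hk, mul_zero, trace_leftMul_weyl_comp_eq_zero θ hφ hD hk]

theorem isDiagonal_laplacianNegPower {s : ℝ} (hs : 0 < s) :
    IsDiagonal (weylBasis θ) (fun k => ((laplaceEigenvalue k ^ (-s) : ℝ) : ℂ))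
      (laplacianNegPower θ s) :=
  (isEigenbasis_weylBasis θ).isDiagonal_negPower laplaceEigenvalue_nonneg
    tendsto_laplaceEigenvalue_cofinite hs

theorem exists_isDiagonal_laplacianNegPower_tendsto (hn : n ≠ 0) :
    ∃ (b : HilbertBasis ℕ ℂ (Hilb θ)) (d : ℕ → ℝ),
      IsDiagonal b (fun m => (d m : ℂ)) (laplacianNegPower θ ((n : ℝ) / 2)) ∧ (∀ m, 0 ≤ d m) ∧
        Tendsto (fun m : ℕ => ((m : ℝ) + 1) * d m) atTop (𝓝 (sphereArea n / n)) := by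
  have : Nonempty (Fin n) := ⟨⟨0, Nat.pos_of_ne_zero hn⟩⟩
  obtain ⟨σ, hσ⟩ := exists_equiv_nat_tendsto_mul_laplaceEigenvalue_rpow (ι := Fin n)
  rw [Fintype.card_fin, volume_real_ball_eq_sphereArea_div hn] at hσ
  exact ⟨reindexHilbertBasis (weylBasis θ) σ, _,
    (isDiagonal_laplacianNegPower θ (by positivity)).reindex σ,
    fun m => Real.rpow_nonneg (laplaceEigenvalue_nonneg _) _, hσ⟩

theorem laplacianNegPower_mem_weakTraceClass (hn : n ≠ 0) :
    laplacianNegPower θ ((n : ℝ) / 2) ∈ weakTraceClass (Hilb θ) := by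
  obtain ⟨b, d, h_diag, h_nonneg, h_lim⟩ := exists_isDiagonal_laplacianNegPower_tendsto θ hn
  obtain ⟨C, hC⟩ := h_lim.bddAbove_range
  refine mem_weakTraceClass_of_isDiagonal (C := C) h_diag fun m => ?_
  rw [Complex.norm_real, Real.norm_of_nonneg (h_nonneg m), le_div_iff₀ (by positivity), mul_comm]
  exact hC ⟨m, rfl⟩

end NCTorus

end

theorem corollary7p3_general {n : ℕ} (hn : n ≠ 0) (θ : Matrix (Fin n) (Fin n) ℝ) (a : NCTorus θ) :
    WeakTrace.HasNCIntegral
      (NCTorus.leftMul θ a ∘L NCTorus.laplacianNegPower θ ((n : ℝ) / 2))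
      (((sphereArea n / (n : ℝ) : ℝ) : ℂ) * NCTorus.tau θ a) := by
  have h_mem := NCTorus.laplacianNegPower_mem_weakTraceClass θ hn
  have h_weyl := NCTorus.isDiagonal_laplacianNegPower θ (s := (n : ℝ) / 2) (by positivity)
  refine ⟨WeakTrace.comp_left_mem _ h_mem, fun φ hφ => ?_⟩
  obtain ⟨b, d, h_diag, -, h_lim⟩ := NCTorus.exists_isDiagonal_laplacianNegPower_tendsto θ hn
  have h_trace : φ ⟨_, h_mem⟩ = ((sphereArea n / n : ℝ) : ℂ) := hφ.map_eq_of_tendsto h_diag h_lim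
  rw [← h_trace]
  exact NCTorus.trace_leftMul_comp_eq_mul_tau θ hφ (D := ⟨_, h_mem⟩) h_weyl
    (fun k => Complex.zero_le_real.2 (Real.rpow_nonneg (laplaceEigenvalue_nonneg k) _)) a

theorem corollary7p3 (n : ℕ) (hn : 2 ≤ n) (θ : Matrix (Fin n) (Fin n) ℝ)
    (hθ : θ.transpose = -θ) (a : NCTorus θ) :
    WeakTrace.IsStronglyMeasurable
        (NCTorus.leftMul θ a ∘L NCTorus.laplacianNegPower θ ((n : ℝ) / 2)) ∧
      WeakTrace.HasNCIntegral
        (NCTorus.leftMul θ a ∘L NCTorus.laplacianNegPower θ ((n : ℝ) / 2))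
        (((sphereArea n / (n : ℝ) : ℝ) : ℂ) * NCTorus.tau θ a) := by
  have h := corollary7p3_general (by lia : n ≠ 0) θ a
  exact ⟨⟨_, h⟩, h⟩
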